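/- Let $n\ge 1$ and $\lambda_p,\lambda_d,r_d>0$. Let $\Phi$ be the Matérn cluster process on $\mathbb{R}^n$ with these parameters: the parent points $\{X_i\}$ form a homogeneous Poisson point process on $\mathbb{R}^n$ of intensity $\lambda_p$; the daughter processes $\Phi_i$ are i.i.d. Poisson point processes, independent of the parents, with intensity $\lambda_d$ on the closed ball of radius $r_d$ centred at the origin and no points outside it; and $\Phi=\bigcup_i (X_i+\Phi_i)$. For $k\ge1$ let $R_k$ be the distance from an arbitrary fixed point of $\mathbb{R}^n$ to the $k$-th closest point of $\Phi$. Put $v_n=\pi^{n/2}/\Gamma(\tfrac n2+1)$, let $\mathcal{A}(r,r_d,x)$ be the volume of the intersection of two balls of $\mathbb{R}^n$ with radii $r$ and $r_d$ whose centres are at distance $x$, and for $j\ge0$ and $r\ge 0$ let $$h_j(r)=\frac{\lambda_p n v_n}{j!}\int_0^{r+r_d}\bigl(\lambda_d\mathcal{A}(r,r_d,x)\bigr)^j e^{-\lambda_d\mathcal{A}(r,r_d,x)}x^{n-1}\,dx .$$ Then $R_k$ is a random variable, and for every $r\ge0$ its cumulative distribution function $F_{R_k}(r)=\mathbb{P}(R_k\le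 r)$ is $$F_{R_k}(r)=1-e^{h_0(r)-\lambda_p v_n(r+r_d)^n}\sum_{m=0}^{k-1}\ \sum_{(b_1,\dots,b_m)\in B_m}\ \prod_{i=1}^m\frac{h_i(r)^{b_i}}{b_i!},$$ where $B_m$ is the set of all $m$-tuples of non-negative integers with $b_1+2b_2+\dots+m b_m=m$ (so $B_0$ consists of the empty tuple, which contributes $1$). -/

import Mathlib

open MeasureTheory ProbabilityTheory
open scoped ENNReal NNReal

noncomputable section

/-- The counting measure of a configuration `S` of points:
`configMeasure S B` is the number of points of `S` in `B`, for every measurable set `B`. -/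
def configMeasure {E : Type*} [MeasurableSpace E] (S : Set E) : Measure E :=
  Measure.sum fun x : S => Measure.dirac (x : E)

theorem configMeasure_apply {E : Type*} [MeasurableSpace E] (S : Set E) {B : Set E}
    (hB : MeasurableSet B) : configMeasure S B = ((S ∩ B).encard : ℝ≥0∞) := by
  have h1 : configMeasure S B = ∑' x : S, (B.indicator (fun _ => (1 : ℝ≥0∞))) (x : E) := by
    simp [configMeasure, Measure.sum_apply _ hB, Measure.dirac_apply' _ hB, Pi.one_def]
  rw [h1, tsum_subtype S (B.indicator fun _ => (1 : ℝ≥0∞)), Set.indicator_indicator,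
    ← tsum_subtype (S ∩ B) (fun _ => (1 : ℝ≥0∞)), ENNReal.tsum_set_one]

/-- The random set of points `Φ` is a Poisson point process with intensity measure `μ`:
the number of points in each set of finite intensity `μ B` is Poisson distributed with mean `μ B`,
and the numbers of points in pairwise disjoint sets are independent. -/
structure IsPoissonPointProcess {Ω E : Type*} [MeasurableSpace Ω] [MeasurableSpace E]
    (Φ : Ω → Set E) (μ : Measure E) (P : Measure Ω) : Prop where
  measurable : Measurable fun ω => configMeasure (Φ ω)
  law : ∀ B : Set E, MeasurableSet B → μ B ≠ ∞ →
    P.map (fun ω => configMeasure (Φ ω) B)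
      = (poissonMeasure (μ B).toNNReal).map (fun j : ℕ => (j : ℝ≥0∞))
  indep : ∀ (m : ℕ) (B : Fin m → Set E), (∀ j, MeasurableSet (B j)) →
    Pairwise (fun i j => Disjoint (B i) (B j)) →
    iIndepFun (fun (j : Fin m) ω => configMeasure (Φ ω) (B j)) P

/-- `X i` are the parent points and `C i` is the daughter process attached to the parent `X i`
(relative to that parent): the parents form a Poisson point process of constant intensity `lamP`
on `ℝⁿ`, each daughter process is Poisson with intensity `lamD` on the closed ball of radius `rd`
around the origin, and the daughter processes are independent of one another and of the
parents. -/
structure IsMaternClustering {Ω : Type*} [MeasurableSpace Ω] {n : ℕ}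
    (X : ℕ → Ω → EuclideanSpace ℝ (Fin n)) (C : ℕ → Ω → Set (EuclideanSpace ℝ (Fin n)))
    (lamP lamD rd : ℝ) (P : Measure Ω) : Prop where
  measurable_parent : ∀ i, Measurable (X i)
  parent_injective : ∀ᵐ ω ∂P, Function.Injective fun i => X i ω
  parent : IsPoissonPointProcess (fun ω => Set.range fun i => X i ω)
    (ENNReal.ofReal lamP • (volume : Measure (EuclideanSpace ℝ (Fin n)))) P
  daughter : ∀ i, IsPoissonPointProcess (C i)
    (ENNReal.ofReal lamD •
      (volume : Measure (EuclideanSpace ℝ (Fin n))).restrict (Metric.closedBall 0 rd)) P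
  daughter_indep : iIndepFun (fun i ω => configMeasure (C i ω)) P
  parent_indep_daughter :
    IndepFun (fun ω i => X i ω) (fun ω i => configMeasure (C i ω)) P

/-- `Φ` is an `n`-dimensional Matérn cluster process with parent intensity `lamP`, daughter
intensity `lamD` and cluster radius `rd`: it is the union of the daughter processes, each
translated by its parent. -/
def IsMaternClusterProcess {Ω : Type*} [MeasurableSpace Ω] {n : ℕ}
    (Φ : Ω → Set (EuclideanSpace ℝ (Fin n))) (lamP lamD rd : ℝ) (P : Measure Ω) : Prop :=
  ∃ (X : ℕ → Ω → EuclideanSpace ℝ (Fin n)) (C : ℕ → Ω → Set (EuclideanSpace ℝ (Fin n))),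
    IsMaternClustering X C lamP lamD rd P ∧
      ∀ᵐ ω ∂P, Φ ω = ⋃ i, (fun z => X i ω + z) '' C i ω

/-- The distance from `y` to the `k`-th closest point of `S`: the smallest radius of a closed ball
around `y` that contains at least `k` points of `S` (`∞` if `S` has fewer than `k` points). -/
def kthDist {E : Type*} [PseudoMetricSpace E] (k : ℕ) (y : E) (S : Set E) : ℝ≥0∞ :=
  ⨅ (ρ : ℝ≥0) (_ : (k : ℕ∞) ≤ (S ∩ Metric.closedBall y ρ).encard), (ρ : ℝ≥0∞)

/-- The volume `v_n` of the unit ball of `ℝⁿ`. -/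
def unitBallVolume (n : ℕ) : ℝ := Real.pi ^ ((n : ℝ) / 2) / Real.Gamma ((n : ℝ) / 2 + 1)

/-- The volume of the intersection of two balls of `ℝⁿ` with radii `r` and `rd` whose centres, the
origin and a point on the first coordinate axis, are at distance `x`. -/
def interVolume (n : ℕ) [NeZero n] (r rd x : ℝ) : ℝ :=
  (volume : Measure (EuclideanSpace ℝ (Fin n))).real
    (Metric.closedBall 0 r ∩ Metric.closedBall (EuclideanSpace.single 0 x) rd)

/-- The functions `h_k(r)`, for `k = 0` as well. -/
def hCoeff (n : ℕ) [NeZero n] (lamP lamD rd : ℝ) (k : ℕ) (r : ℝ) : ℝ :=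
  lamP * n * unitBallVolume n / k.factorial *
    ∫ x in (0 : ℝ)..(r + rd),
      (lamD * interVolume n r rd x) ^ k * Real.exp (-(lamD * interVolume n r rd x)) * x ^ (n - 1)

/-- The set of all tuples `(b_1, …, b_m)` of natural numbers with `b_1 + 2 b_2 + ⋯ + m b_m = m`
(the entry `b_{i+1}` is `b i`). -/
def tupleSet (m : ℕ) : Finset (Fin m → ℕ) :=
  (Fintype.piFinset fun _ : Fin m => Finset.range (m + 1)).filter
    fun b => ∑ i : Fin m, ((i : ℕ) + 1) * b i = m

theorem mem_tupleSet {m : ℕ} (b : Fin m → ℕ) :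
    b ∈ tupleSet m ↔ ∑ i : Fin m, ((i : ℕ) + 1) * b i = m := by
  simp only [tupleSet, Finset.mem_filter, Fintype.mem_piFinset, Finset.mem_range,
    and_iff_right_iff_imp]
  intro h i
  have h1 : ((i : ℕ) + 1) * b i ≤ ∑ j : Fin m, ((j : ℕ) + 1) * b j :=
    Finset.single_le_sum (f := fun j : Fin m => ((j : ℕ) + 1) * b j)
      (fun _ _ => Nat.zero_le _) (Finset.mem_univ i)
  nlinarith [Nat.zero_le ((i : ℕ) * b i)]

end

/-!
The law of the number `N` of points of `Φ` in the closed ball of radius `r` around `y` is found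
through its generating function. Given the parents, the clusters contribute independent Poisson
numbers of points to the ball, and the parents themselves form a Poisson process, so applying the
Laplace functional of a Poisson process twice gives `E[s^N] = exp (∑ a_j s^j)`. Here `a_j = h_j(r)`
for `j ≥ 1` is the mean number of parents with exactly `j` daughters in the ball, and
`a_0 = h_0(r) - λ_p v_n (r + r_d)^n` is minus the mean number of parents with at least one.
The logarithmic derivative turns this into the recurrence
`m P(N = m) = ∑_j j a_j P(N = m - j)`, which is solved by sums over the tuples in `B_m`;
finally `R_k ≤ r` if and only if `N ≥ k`.

That `N` is the sum of the contributions of the clusters requires the clusters to be almost surely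
disjoint, which holds because the daughter intensity has no atoms.
-/

noncomputable section

open Filter Topology

/-- The function `u ↦ e^{-u}` on `[0, ∞]`, with value `0` at `∞`. -/
def expNeg (u : ℝ≥0∞) : ℝ≥0∞ := EReal.exp (-(u : EReal))

@[simp] theorem expNeg_zero : expNeg 0 = 1 := by simp [expNeg]

@[simp] theorem expNeg_top : expNeg ∞ = 0 := by simp [expNeg]

theorem expNeg_ofReal {x : ℝ} (hx : 0 ≤ x) :
    expNeg (ENNReal.ofReal x) = ENNReal.ofReal (Real.exp (-x)) := by
  rw [expNeg, EReal.coe_ennreal_ofReal, max_eq_left hx, ← EReal.coe_neg, EReal.exp_coe]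

theorem antitone_expNeg : Antitone expNeg := fun _ _ h =>
  EReal.exp_monotone (EReal.neg_le_neg_iff.2 (EReal.coe_ennreal_le_coe_ennreal_iff.2 h))

theorem expNeg_le_one (u : ℝ≥0∞) : expNeg u ≤ 1 :=
  expNeg_zero ▸ antitone_expNeg (zero_le (a := u))

theorem toReal_expNeg_le_one (u : ℝ≥0∞) : (expNeg u).toReal ≤ 1 :=
  ENNReal.toReal_mono ENNReal.one_ne_top (expNeg_le_one u)

theorem expNeg_ne_top (u : ℝ≥0∞) : expNeg u ≠ ∞ :=
  ne_top_of_le_ne_top ENNReal.one_ne_top (expNeg_le_one u)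

theorem expNeg_add (u v : ℝ≥0∞) : expNeg (u + v) = expNeg u * expNeg v := by
  rw [expNeg, expNeg, expNeg, ← EReal.exp_add, EReal.coe_ennreal_add,
    EReal.neg_add (by simp) (by simp), sub_eq_add_neg]

theorem expNeg_sum {ι : Type*} (s : Finset ι) (u : ι → ℝ≥0∞) :
    expNeg (∑ i ∈ s, u i) = ∏ i ∈ s, expNeg (u i) := by
  classical
  induction s using Finset.induction_on with
  | empty => simp
  | insert i s hi ih => rw [Finset.sum_insert hi, Finset.prod_insert hi, expNeg_add, ih]

theorem expNeg_mul_natCast (u : ℝ≥0∞) (j : ℕ) : expNeg (u * j) = expNeg u ^ j := by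
  simpa [mul_comm] using expNeg_sum (Finset.range j) fun _ => u

theorem one_sub_expNeg_ofReal {x : ℝ} (hx : 0 ≤ x) :
    1 - expNeg (ENNReal.ofReal x) = ENNReal.ofReal (1 - Real.exp (-x)) := by
  rw [expNeg_ofReal hx, ENNReal.ofReal_sub _ (Real.exp_nonneg _), ENNReal.ofReal_one]

theorem one_sub_expNeg_le (u : ℝ≥0∞) : 1 - expNeg u ≤ u := by
  induction u with
  | top => exact le_top
  | coe u =>
    rw [← ENNReal.ofReal_coe_nnreal, one_sub_expNeg_ofReal u.coe_nonneg]
    exact ENNReal.ofReal_le_ofReal (by linarith [Real.add_one_le_exp (-(u : ℝ))])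

theorem continuous_expNeg : Continuous expNeg :=
  ENNReal.continuous_exp.comp (continuous_neg.comp continuous_coe_ennreal_ereal)

@[fun_prop] theorem measurable_expNeg : Measurable expNeg := continuous_expNeg.measurable

theorem poissonMeasure_zero : poissonMeasure 0 = Measure.dirac 0 :=
  Measure.ext_of_singleton fun n => by rcases n with _ | n <;> simp [poissonMeasure_singleton]

theorem hasSum_pow_div_factorial_mul_exp_neg (u s : ℝ) :
    HasSum (fun j : ℕ => u ^ j / j.factorial * Real.exp (-u) * s ^ j)
      (Real.exp (-((1 - s) * u))) := by
  have h := (NormedSpace.expSeries_div_hasSum_exp (s * u)).mul_left (Real.exp (-u))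
  rw [← Real.exp_eq_exp_ℝ, ← Real.exp_add, show -u + s * u = -((1 - s) * u) by ring] at h
  refine h.congr_fun fun j => ?_
  rw [mul_pow]
  ring

theorem lintegral_pow_poissonMeasure (r : ℝ≥0) {q : ℝ} (hq : 0 ≤ q) :
    ∫⁻ j : ℕ, ENNReal.ofReal q ^ j ∂poissonMeasure r
      = ENNReal.ofReal (Real.exp (-((1 - q) * r))) := by
  have hsum := hasSum_pow_div_factorial_mul_exp_neg r q
  rw [lintegral_countable', ← hsum.tsum_eq,
    ENNReal.ofReal_tsum_of_nonneg (fun j => by positivity) hsum.summable]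
  refine tsum_congr fun j => ?_
  rw [poissonMeasure_singleton, ← ENNReal.ofReal_pow hq, ← ENNReal.ofReal_mul (by positivity)]
  ring_nf

theorem lintegral_expNeg_mul_poissonMeasure (a : ℝ≥0∞) (r : ℝ≥0) :
    ∫⁻ j : ℕ, expNeg (a * j) ∂poissonMeasure r = expNeg ((1 - expNeg a) * r) := by
  have hq : ENNReal.ofReal (expNeg a).toReal = expNeg a := ENNReal.ofReal_toReal (expNeg_ne_top a)
  have hq1 : (expNeg a).toReal ≤ 1 := toReal_expNeg_le_one a
  have hr : (1 - expNeg a) * r = ENNReal.ofReal ((1 - (expNeg a).toReal) * r) := by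
    rw [ENNReal.ofReal_mul (by linarith), ENNReal.ofReal_sub _ ENNReal.toReal_nonneg, hq]
    simp
  simp_rw [expNeg_mul_natCast, hr, expNeg_ofReal (mul_nonneg (sub_nonneg.2 hq1) r.coe_nonneg),
    ← lintegral_pow_poissonMeasure r ENNReal.toReal_nonneg, hq]

theorem exists_monotone_simpleFunc_finMeasSupp_tendsto {E : Type*} [MeasurableSpace E]
    (μ : Measure E) [SigmaFinite μ] {f : E → ℝ≥0∞} (hf : Measurable f) :
    ∃ F : ℕ → SimpleFunc E ℝ≥0∞, Monotone F ∧ (∀ n, (F n).FinMeasSupp μ) ∧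
      ∀ x, Tendsto (fun n => F n x) atTop (𝓝 (f x)) := by
  refine ⟨fun n => (SimpleFunc.eapprox f n).restrict (spanningSets μ n), fun m n hmn x => ?_,
    fun n => ?_, fun x => ?_⟩
  · simp only [SimpleFunc.restrict_apply _ (measurableSet_spanningSets μ _)]
    exact (Set.indicator_le_indicator (SimpleFunc.monotone_eapprox f hmn x)).trans
      (Set.indicator_le_indicator_of_subset (monotone_spanningSets μ hmn) (fun _ => zero_le) x)
  · rw [SimpleFunc.finMeasSupp_iff_support,
      SimpleFunc.coe_restrict _ (measurableSet_spanningSets μ n)]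
    exact (measure_mono Set.support_indicator_subset).trans_lt (measure_spanningSets_lt_top μ n)
  · refine (SimpleFunc.tendsto_eapprox hf x).congr' ?_
    filter_upwards [eventually_mem_spanningSets μ x] with n hn
    rw [SimpleFunc.restrict_apply _ (measurableSet_spanningSets μ n), Set.indicator_of_mem hn]

namespace IsPoissonPointProcess

variable {Ω E : Type*} [MeasurableSpace Ω] [MeasurableSpace E] {Φ : Ω → Set E} {μ : Measure E}
  {P : Measure Ω}

theorem isProbabilityMeasure (h : IsPoissonPointProcess Φ μ P) : IsProbabilityMeasure P :=
  (h.indep 0 Fin.elim0 (fun j => j.elim0) fun j => j.elim0).isProbabilityMeasure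

theorem measurable_count (h : IsPoissonPointProcess Φ μ P) {B : Set E} (hB : MeasurableSet B) :
    Measurable fun ω => configMeasure (Φ ω) B :=
  (Measure.measurable_coe hB).comp h.measurable

theorem lintegral_expNeg_mul_count (h : IsPoissonPointProcess Φ μ P) {B : Set E}
    (hB : MeasurableSet B) (hμ : μ B ≠ ∞) (a : ℝ≥0∞) :
    ∫⁻ ω, expNeg (a * configMeasure (Φ ω) B) ∂P = expNeg ((1 - expNeg a) * μ B) := by
  have hmeas : Measurable fun u => expNeg (a * u) := by fun_prop
  rw [← lintegral_map hmeas (h.measurable_count hB), h.law B hB hμ,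
    lintegral_map hmeas (by fun_prop), lintegral_expNeg_mul_poissonMeasure, ENNReal.coe_toNNReal hμ]

theorem ae_count_lt_top (h : IsPoissonPointProcess Φ μ P) {B : Set E}
    (hB : MeasurableSet B) (hμ : μ B ≠ ∞) : ∀ᵐ ω ∂P, configMeasure (Φ ω) B < ∞ := by
  have hlaw : ∀ᵐ u ∂(P.map fun ω => configMeasure (Φ ω) B), u < ∞ := by
    rw [h.law B hB hμ, ae_map_iff (by fun_prop) measurableSet_Iio]
    simp
  exact ae_of_ae_map (h.measurable_count hB).aemeasurable hlaw

theorem ae_count_eq_zero (h : IsPoissonPointProcess Φ μ P) {B : Set E} (hB : MeasurableSet B)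
    (hμ : μ B = 0) : ∀ᵐ ω ∂P, configMeasure (Φ ω) B = 0 := by
  have hlaw : ∀ᵐ u ∂(P.map fun ω => configMeasure (Φ ω) B), u = 0 := by
    rw [h.law B hB (by simp [hμ]), hμ, ENNReal.toNNReal_zero, poissonMeasure_zero,
      Measure.map_dirac' (f := fun j : ℕ => (j : ℝ≥0∞)) (by fun_prop)]
    simp
  exact ae_of_ae_map (h.measurable_count hB).aemeasurable hlaw

theorem lintegral_expNeg_simpleFunc (h : IsPoissonPointProcess Φ μ P) (f : SimpleFunc E ℝ≥0∞)
    (hf : f.FinMeasSupp μ) :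
    ∫⁻ ω, expNeg (∫⁻ x, f x ∂configMeasure (Φ ω)) ∂P = expNeg (∫⁻ x, (1 - expNeg (f x)) ∂μ) := by
  classical
  have hsum (ω : Ω) : expNeg (∫⁻ x, f x ∂configMeasure (Φ ω))
      = ∏ a : f.range, expNeg (a * configMeasure (Φ ω) (f ⁻¹' {(a : ℝ≥0∞)})) := by
    rw [SimpleFunc.lintegral_eq_lintegral, SimpleFunc.lintegral, expNeg_sum,
      ← Finset.prod_coe_sort]
  have hindep : iIndepFun
      (fun (a : f.range) ω => expNeg (a * configMeasure (Φ ω) (f ⁻¹' {(a : ℝ≥0∞)}))) P := by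
    have hfin := h.indep _ (fun j => f ⁻¹' {((f.range.equivFin.symm j : f.range) : ℝ≥0∞)})
      (fun j => f.measurableSet_preimage _) fun i j hij => Disjoint.preimage _ <|
        Set.disjoint_singleton.2 fun hh => hij (f.range.equivFin.symm.injective (Subtype.ext hh))
    have hrange := hfin.precomp f.range.equivFin.injective
    simp only [Equiv.symm_apply_apply] at hrange
    exact hrange.comp (fun a u => expNeg (a * u)) fun a => by fun_prop
  have hfactor (a : ℝ≥0∞) : ∫⁻ ω, expNeg (a * configMeasure (Φ ω) (f ⁻¹' {a})) ∂P
      = expNeg ((1 - expNeg a) * μ (f ⁻¹' {a})) := by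
    have := h.isProbabilityMeasure
    rcases eq_or_ne a 0 with rfl | ha
    · simp
    · exact h.lintegral_expNeg_mul_count (f.measurableSet_preimage _)
        (SimpleFunc.finMeasSupp_iff.1 hf a ha).ne a
  calc ∫⁻ ω, expNeg (∫⁻ x, f x ∂configMeasure (Φ ω)) ∂P
      = ∏ a : f.range, expNeg ((1 - expNeg a) * μ (f ⁻¹' {(a : ℝ≥0∞)})) := by
        simp_rw [hsum, ← hfactor]
        exact lintegral_prod_eq_prod_lintegral_of_indepFun _ _ hindep fun a =>
          measurable_expNeg.comp ((h.measurable_count (f.measurableSet_preimage _)).const_mul _)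
    _ = expNeg (∫⁻ x, (1 - expNeg (f x)) ∂μ) := by
        rw [Finset.prod_coe_sort f.range fun a => expNeg ((1 - expNeg a) * μ (f ⁻¹' {a})),
          ← expNeg_sum, ← SimpleFunc.map_lintegral (fun a => 1 - expNeg a) f,
          ← SimpleFunc.lintegral_eq_lintegral]
        rfl

theorem lintegral_expNeg_lintegral [SigmaFinite μ] (h : IsPoissonPointProcess Φ μ P)
    {f : E → ℝ≥0∞} (hf : Measurable f) :
    ∫⁻ ω, expNeg (∫⁻ x, f x ∂configMeasure (Φ ω)) ∂P = expNeg (∫⁻ x, (1 - expNeg (f x)) ∂μ) := by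
  have := h.isProbabilityMeasure
  obtain ⟨F, hmono, hfin, hlim⟩ := exists_monotone_simpleFunc_finMeasSupp_tendsto μ hf
  have hlhs : Tendsto (fun n => ∫⁻ ω, expNeg (∫⁻ x, F n x ∂configMeasure (Φ ω)) ∂P) atTop
      (𝓝 (∫⁻ ω, expNeg (∫⁻ x, f x ∂configMeasure (Φ ω)) ∂P)) := by
    refine tendsto_lintegral_of_dominated_convergence (fun _ => 1)
      (fun n => measurable_expNeg.comp ((Measure.measurable_lintegral (F n).measurable).comp
        h.measurable)) (fun n => ae_of_all _ fun ω => expNeg_le_one _) (by simp)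
      (ae_of_all _ fun ω => (continuous_expNeg.tendsto _).comp ?_)
    exact lintegral_tendsto_of_tendsto_of_monotone (fun n => (F n).measurable.aemeasurable)
      (ae_of_all _ fun x m n hmn => hmono hmn x) (ae_of_all _ hlim)
  have hrhs : Tendsto (fun n => expNeg (∫⁻ x, (1 - expNeg (F n x)) ∂μ)) atTop
      (𝓝 (expNeg (∫⁻ x, (1 - expNeg (f x)) ∂μ))) := by
    refine (continuous_expNeg.tendsto _).comp (lintegral_tendsto_of_tendsto_of_monotone
      (fun n => by fun_prop) (ae_of_all _ fun x m n hmn => ?_) (ae_of_all _ fun x => ?_))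
    · exact tsub_le_tsub_left (antitone_expNeg (hmono hmn x)) 1
    · exact ENNReal.Tendsto.sub tendsto_const_nhds ((continuous_expNeg.tendsto _).comp (hlim x))
        (Or.inl ENNReal.one_ne_top)
  refine tendsto_nhds_unique (hlhs.congr fun n => ?_) hrhs
  exact h.lintegral_expNeg_simpleFunc (F n) (hfin n)

end IsPoissonPointProcess

section FiniteKernel

variable {E : Type*} [MeasurableSpace E]

/-- The kernel that normalises a finite measure to total mass `1`. It sends an infinite measure
to `0`, because `∞⁻¹ = 0`. -/
def normalizedKernel (E : Type*) [MeasurableSpace E] : Kernel (Measure E) E where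
  toFun μ := (μ Set.univ)⁻¹ • μ
  measurable' := by
    refine Measure.measurable_of_measurable_coe _ fun s hs => ?_
    exact (Measure.measurable_coe MeasurableSet.univ).inv.mul (Measure.measurable_coe hs)

instance : IsFiniteKernel (normalizedKernel E) :=
  ⟨⟨1, ENNReal.one_lt_top, fun μ => ENNReal.inv_mul_le_one (μ Set.univ)⟩⟩

/-- The identity kernel on the finite measures, set to `0` at the infinite ones. Unlike the
identity on all measures it is s-finite, which gives the joint measurability of
`(μ, x) ↦ μ (s x)` for measurable families of sets. -/
def finiteKernel (E : Type*) [MeasurableSpace E] : Kernel (Measure E) E :=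
  (normalizedKernel E).withDensity fun μ _ => (μ Set.univ).toNNReal

theorem finiteKernel_apply (μ : Measure E) :
    finiteKernel E μ = ((μ Set.univ).toNNReal : ℝ≥0∞) • (μ Set.univ)⁻¹ • μ := by
  rw [finiteKernel, Kernel.withDensity_apply _ (by
    exact ((Measure.measurable_coe MeasurableSet.univ).ennreal_toNNReal.coe_nnreal_ennreal).comp
      measurable_fst), withDensity_const]
  rfl

theorem finiteKernel_of_isFiniteMeasure (μ : Measure E) [IsFiniteMeasure μ] :
    finiteKernel E μ = μ := by
  rw [finiteKernel_apply, ENNReal.coe_toNNReal (measure_ne_top μ _), smul_smul]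
  rcases eq_or_ne μ 0 with rfl | hμ
  · simp
  · rw [ENNReal.mul_inv_cancel (by simpa using hμ) (measure_ne_top μ _), one_smul]

theorem finiteKernel_absolutelyContinuous (μ : Measure E) : finiteKernel E μ ≪ μ := by
  rw [finiteKernel_apply, smul_smul]
  exact Measure.smul_absolutelyContinuous

instance : IsSFiniteKernel (finiteKernel E) := by unfold finiteKernel; infer_instance

theorem measurable_finiteKernel_apply {α : Type*} [MeasurableSpace α] {M : α → Measure E}
    (hM : Measurable M) {s : α → Set E} (hs : MeasurableSet {q : α × E | q.2 ∈ s q.1}) :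
    Measurable fun a => finiteKernel E (M a) (s a) :=
  Kernel.measurable_kernel_prodMk_left (κ := (finiteKernel E).comap M hM) hs

end FiniteKernel

section Independence

variable {Ω α β : Type*} [MeasurableSpace Ω] [MeasurableSpace α] [MeasurableSpace β]
  {P : Measure Ω}

theorem lintegral_comp_prodMk_of_indepFun [IsFiniteMeasure P] {U : Ω → α} {V : Ω → β}
    (h : IndepFun U V P) (hU : Measurable U) (hV : Measurable V) {F : α × β → ℝ≥0∞}
    (hF : Measurable F) : ∫⁻ ω, F (U ω, V ω) ∂P = ∫⁻ ω, ∫⁻ ω', F (U ω, V ω') ∂P ∂P := by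
  rw [← lintegral_map hF (hU.prodMk hV),
    (indepFun_iff_map_prod_eq_prod_map_map hU.aemeasurable hV.aemeasurable).1 h,
    lintegral_prod _ hF.aemeasurable, lintegral_map hF.lintegral_prod_right' hU]
  exact lintegral_congr fun ω => lintegral_map (hF.comp measurable_prodMk_left) hV

theorem lintegral_expNeg_tsum {u : ℕ → Ω → ℝ≥0∞} (hindep : iIndepFun u P)
    (hu : ∀ i, Measurable (u i)) {g : ℕ → ℝ≥0∞}
    (hg : ∀ i, ∫⁻ ω, expNeg (u i ω) ∂P = expNeg (g i)) :
    ∫⁻ ω, expNeg (∑' i, u i ω) ∂P = expNeg (∑' i, g i) := by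
  have := hindep.isProbabilityMeasure
  have hexp (v : ℕ → ℝ≥0∞) :
      Tendsto (fun N => ∏ i ∈ Finset.range N, expNeg (v i)) atTop (𝓝 (expNeg (∑' i, v i))) := by
    simp_rw [← expNeg_sum]
    exact (continuous_expNeg.tendsto _).comp (ENNReal.tendsto_nat_tsum v)
  refine tendsto_nhds_unique (tendsto_lintegral_of_dominated_convergence (fun _ => 1)
    (fun N => Finset.measurable_fun_prod _ fun i _ => measurable_expNeg.comp (hu i))
    (fun N => ae_of_all _ fun ω => Finset.prod_le_one' fun i _ => expNeg_le_one _)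
    (by simp) (ae_of_all _ fun ω => hexp fun i => u i ω)) ((hexp g).congr fun N => ?_)
  simp_rw [← hg]
  exact (lintegral_prod_eq_prod_lintegral_of_indepFun _ _
    (hindep.comp (fun _ => expNeg) fun _ => measurable_expNeg)
    fun i => measurable_expNeg.comp (hu i)).symm

end Independence

section ConfigMeasure

variable {E : Type*} [MeasurableSpace E]

theorem configMeasure_iUnion {ι : Type*} [Countable ι] {S : ι → Set E}
    (hS : Pairwise fun i j => Disjoint (S i) (S j)) {B : Set E} (hB : MeasurableSet B) :
    configMeasure (⋃ i, S i) B = ∑' i, configMeasure (S i) B := by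
  simp_rw [configMeasure_apply _ hB, Set.iUnion_inter]
  let _ : MeasurableSpace E := ⊤
  simpa only [Measure.count_apply MeasurableSpace.measurableSet_top] using
    measure_iUnion (μ := (Measure.count : Measure E)) (f := fun i => S i ∩ B)
      (fun i j hij => (hS hij).mono Set.inter_subset_left Set.inter_subset_left)
      fun i => MeasurableSpace.measurableSet_top

theorem configMeasure_image {f : E → E} (hf : Measurable f) (hinj : Function.Injective f)
    (S : Set E) {B : Set E} (hB : MeasurableSet B) :
    configMeasure (f '' S) B = configMeasure S (f ⁻¹' B) := by
  rw [configMeasure_apply _ hB, configMeasure_apply _ (hf hB), ← Set.image_inter_preimage,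
    hinj.encard_image]

theorem lintegral_configMeasure_range {X : ℕ → E} (hX : Function.Injective X) {f : E → ℝ≥0∞}
    (hf : Measurable f) : ∫⁻ x, f x ∂configMeasure (Set.range X) = ∑' i, f (X i) := by
  rw [configMeasure, lintegral_sum_measure]
  simp_rw [lintegral_dirac' _ hf]
  exact tsum_range f hX

theorem notMem_of_configMeasure_singleton_eq_zero [MeasurableSingletonClass E] {S : Set E} {z : E}
    (h : configMeasure S {z} = 0) : z ∉ S := by
  rw [configMeasure_apply S (measurableSet_singleton z)] at h
  simpa using h

end ConfigMeasure

section Overlap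

variable {E : Type*} [MeasurableSpace E] [MeasurableEq E]

theorem measurable_finiteKernel_singleton {α : Type*} [MeasurableSpace α] {M : α → Measure E}
    (hM : Measurable M) {f : α → E} (hf : Measurable f) :
    Measurable fun a => finiteKernel E (M a) {f a} :=
  measurable_finiteKernel_apply hM (measurableSet_eq_fun measurable_snd (hf.comp measurable_fst))

variable [AddGroup E] [MeasurableAdd₂ E]

/-- The mass that `μ₂` gives to the translate `x + μ₁`: for counting measures, the number of
points that the translated first configuration shares with the second one. -/
def overlap (x : E) (μ₁ μ₂ : Measure E) : ℝ≥0∞ :=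
  ∫⁻ z, finiteKernel E μ₂ {x + z} ∂finiteKernel E μ₁

theorem measurable_overlap {α : Type*} [MeasurableSpace α] {f : α → E} (hf : Measurable f)
    {M₁ M₂ : α → Measure E} (hM₁ : Measurable M₁) (hM₂ : Measurable M₂) :
    Measurable fun a => overlap (f a) (M₁ a) (M₂ a) :=
  Measurable.lintegral_kernel_prod_right (κ := (finiteKernel E).comap M₁ hM₁)
    (f := fun a z => finiteKernel E (M₂ a) {f a + z})
    (measurable_finiteKernel_singleton (by fun_prop) (by fun_prop))

theorem lintegral_overlap_eq_zero {Ω : Type*} [MeasurableSpace Ω] {P : Measure Ω} [SFinite P]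
    {M : Ω → Measure E} (hM : Measurable M) (hatom : ∀ z, ∀ᵐ ω ∂P, M ω {z} = 0) (x : E)
    (μ₁ : Measure E) : ∫⁻ ω, overlap x μ₁ (M ω) ∂P = 0 := by
  have hmeas : Measurable fun q : Ω × E => finiteKernel E (M q.1) {x + q.2} :=
    measurable_finiteKernel_singleton (by fun_prop) (by fun_prop)
  unfold overlap
  rw [lintegral_lintegral_swap hmeas.aemeasurable]
  refine lintegral_eq_zero_of_ae_eq_zero <| ae_of_all _ fun z =>
    lintegral_eq_zero_of_ae_eq_zero ?_
  filter_upwards [hatom (x + z)] with ω hω using finiteKernel_absolutelyContinuous _ hω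

theorem disjoint_image_add_of_overlap_eq_zero {x₁ x₂ : E} {S₁ S₂ : Set E}
    [IsFiniteMeasure (configMeasure S₁)] [IsFiniteMeasure (configMeasure S₂)]
    (h : overlap (-x₂ + x₁) (configMeasure S₁) (configMeasure S₂) = 0) :
    Disjoint ((fun z => x₁ + z) '' S₁) ((fun z => x₂ + z) '' S₂) := by
  have hmeas : Measurable fun z => configMeasure S₂ {-x₂ + x₁ + z} := by
    simpa only [finiteKernel_of_isFiniteMeasure] using
      measurable_finiteKernel_singleton (measurable_const (a := configMeasure S₂))
        (measurable_const_add (-x₂ + x₁))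
  simp only [overlap, finiteKernel_of_isFiniteMeasure] at h
  rw [configMeasure, lintegral_sum_measure, ENNReal.tsum_eq_zero] at h
  simp only [lintegral_dirac' _ hmeas] at h
  rw [Set.disjoint_left]
  rintro _ ⟨z, hz, rfl⟩ ⟨w, hw, hwz⟩
  have hw' : -x₂ + x₁ + z = w := by
    rw [add_assoc, ← show x₂ + w = x₁ + z from hwz, neg_add_cancel_left]
  exact notMem_of_configMeasure_singleton_eq_zero (h ⟨z, hz⟩) (hw' ▸ hw)

end Overlap

/-- The union of the clusters `C i`, each translated by its centre `X i`. -/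
def clusterUnion {E : Type*} [Add E] (X : ℕ → E) (C : ℕ → Set E) : Set E :=
  ⋃ i, (fun z => X i + z) '' C i

theorem configMeasure_clusterUnion {E : Type*} [AddGroup E] [MeasurableSpace E] [MeasurableAdd E]
    {X : ℕ → E} {C : ℕ → Set E}
    (hdisj : Pairwise fun i j =>
      Disjoint ((fun z => X i + z) '' C i) ((fun z => X j + z) '' C j))
    {B : Set E} (hB : MeasurableSet B) :
    configMeasure (clusterUnion X C) B
      = ∑' i, configMeasure (C i) ((fun z => X i + z) ⁻¹' B) := by
  rw [clusterUnion, configMeasure_iUnion hdisj hB]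
  exact tsum_congr fun i =>
    configMeasure_image (measurable_const_add _) (add_right_injective _) _ hB

/-- A Poisson cluster process with parents `X i`, a Poisson point process of intensity `μ`, and
clusters `C i`, given relative to their parents: independent Poisson point processes of intensity
`ν` that are independent of the parents. -/
structure IsPoissonClustering {Ω E : Type*} [MeasurableSpace Ω] [MeasurableSpace E]
    (X : ℕ → Ω → E) (C : ℕ → Ω → Set E) (μ ν : Measure E) (P : Measure Ω) : Prop where
  measurable_parent : ∀ i, Measurable (X i)
  parent_injective : ∀ᵐ ω ∂P, Function.Injective fun i => X i ω
  parent : IsPoissonPointProcess (fun ω => Set.range fun i => X i ω) μ P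
  daughter : ∀ i, IsPoissonPointProcess (C i) ν P
  daughter_indep : iIndepFun (fun i ω => configMeasure (C i ω)) P
  parent_indep_daughter : IndepFun (fun ω i => X i ω) (fun ω i => configMeasure (C i ω)) P

namespace IsPoissonClustering

variable {Ω E : Type*} [MeasurableSpace Ω] [MeasurableSpace E]
  {X : ℕ → Ω → E} {C : ℕ → Ω → Set E} {μ ν : Measure E} {P : Measure Ω}

theorem isProbabilityMeasure (h : IsPoissonClustering X C μ ν P) : IsProbabilityMeasure P :=
  h.parent.isProbabilityMeasure

theorem ae_isFiniteMeasure_daughter [IsFiniteMeasure ν] (h : IsPoissonClustering X C μ ν P) :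
    ∀ᵐ ω ∂P, ∀ i, IsFiniteMeasure (configMeasure (C i ω)) := by
  rw [ae_all_iff]
  intro i
  filter_upwards [(h.daughter i).ae_count_lt_top MeasurableSet.univ (measure_ne_top ν _)]
    with ω hω using ⟨hω⟩

theorem lintegral_comp_parent_daughter (h : IsPoissonClustering X C μ ν P)
    {F : (ℕ → E) × (ℕ → Measure E) → ℝ≥0∞} (hF : Measurable F) :
    ∫⁻ ω, F (fun i => X i ω, fun i => configMeasure (C i ω)) ∂P
      = ∫⁻ ω, ∫⁻ ω', F (fun i => X i ω, fun i => configMeasure (C i ω')) ∂P ∂P :=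
  have := h.isProbabilityMeasure
  lintegral_comp_prodMk_of_indepFun h.parent_indep_daughter
    (measurable_pi_lambda _ h.measurable_parent)
    (measurable_pi_lambda _ fun i => (h.daughter i).measurable) hF

variable [AddGroup E] [MeasurableAdd₂ E]

theorem ae_overlap_eq_zero [MeasurableNeg E] [MeasurableEq E] [NullSingletonClass ν]
    (h : IsPoissonClustering X C μ ν P) {i j : ℕ} (hij : i ≠ j) :
    ∀ᵐ ω ∂P, overlap (-X j ω + X i ω) (configMeasure (C i ω)) (configMeasure (C j ω)) = 0 := by
  have := h.isProbabilityMeasure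
  have hatom (z : E) : ∀ᵐ ω ∂P, configMeasure (C j ω) {z} = 0 :=
    (h.daughter j).ae_count_eq_zero (measurableSet_singleton z) (measure_singleton z)
  have hX := h.measurable_parent
  have hC := fun i => (h.daughter i).measurable
  have hint : ∫⁻ ω, overlap (-X j ω + X i ω) (configMeasure (C i ω)) (configMeasure (C j ω)) ∂P
      = 0 := by
    rw [h.lintegral_comp_parent_daughter
      (F := fun q => overlap (-q.1 j + q.1 i) (q.2 i) (q.2 j))
      (measurable_overlap (by fun_prop) (by fun_prop) (by fun_prop))]
    refine lintegral_eq_zero_of_ae_eq_zero <| ae_of_all _ fun ω => ?_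
    refine (lintegral_comp_prodMk_of_indepFun (h.daughter_indep.indepFun hij) (hC i) (hC j)
      (F := fun q => overlap (-X j ω + X i ω) q.1 q.2)
      (measurable_overlap measurable_const measurable_fst measurable_snd)).trans ?_
    exact lintegral_eq_zero_of_ae_eq_zero <| ae_of_all _ fun ω' =>
      lintegral_overlap_eq_zero (hC j) hatom _ _
  exact (lintegral_eq_zero_iff (measurable_overlap (by fun_prop) (hC i) (hC j))).1 hint

theorem ae_pairwise_disjoint_cluster [MeasurableNeg E] [MeasurableEq E] [NullSingletonClass ν]
    [IsFiniteMeasure ν] (h : IsPoissonClustering X C μ ν P) :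
    ∀ᵐ ω ∂P, Pairwise fun i j =>
      Disjoint ((fun z => X i ω + z) '' C i ω) ((fun z => X j ω + z) '' C j ω) := by
  have hoverlap : ∀ᵐ ω ∂P, ∀ i j, i ≠ j →
      overlap (-X j ω + X i ω) (configMeasure (C i ω)) (configMeasure (C j ω)) = 0 := by
    simp only [ae_all_iff]
    exact fun i j hij => h.ae_overlap_eq_zero hij
  filter_upwards [hoverlap, h.ae_isFiniteMeasure_daughter] with ω hω hfin i j hij
  have := hfin i
  have := hfin j
  exact disjoint_image_add_of_overlap_eq_zero (hω i j hij)

theorem count_ae_eq_tsum [MeasurableNeg E] [MeasurableEq E] [NullSingletonClass ν]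
    [IsFiniteMeasure ν] (h : IsPoissonClustering X C μ ν P) {B : Set E} (hB : MeasurableSet B) :
    (fun ω => configMeasure (clusterUnion (X · ω) (C · ω)) B) =ᵐ[P]
      fun ω => ∑' i, finiteKernel E (configMeasure (C i ω)) ((fun z => X i ω + z) ⁻¹' B) := by
  filter_upwards [h.ae_pairwise_disjoint_cluster, h.ae_isFiniteMeasure_daughter] with ω hdisj hfin
  rw [configMeasure_clusterUnion hdisj hB]
  refine tsum_congr fun i => ?_
  have := hfin i
  rw [finiteKernel_of_isFiniteMeasure]

theorem measurable_tsum_finiteKernel_preimage_add {B : Set E} (hB : MeasurableSet B) :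
    Measurable fun q : (ℕ → E) × (ℕ → Measure E) =>
      ∑' i, finiteKernel E (q.2 i) ((fun z => q.1 i + z) ⁻¹' B) :=
  Measurable.tsum fun i => measurable_finiteKernel_apply (by fun_prop) <|
    (show Measurable fun p : ((ℕ → E) × (ℕ → Measure E)) × E => p.1.1 i + p.2 by fun_prop) hB

theorem aemeasurable_count [MeasurableNeg E] [MeasurableEq E] [NullSingletonClass ν]
    [IsFiniteMeasure ν] (h : IsPoissonClustering X C μ ν P) {B : Set E} (hB : MeasurableSet B) :
    AEMeasurable (fun ω => configMeasure (clusterUnion (X · ω) (C · ω)) B) P :=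
  have hX := h.measurable_parent
  have hC := fun i => (h.daughter i).measurable
  ((measurable_tsum_finiteKernel_preimage_add hB).comp
    (show Measurable fun ω => (fun i => X i ω, fun i => configMeasure (C i ω)) by
      fun_prop)).aemeasurable.congr (h.count_ae_eq_tsum hB).symm

theorem lintegral_expNeg_mul_daughter [IsFiniteMeasure ν] (h : IsPoissonClustering X C μ ν P)
    (x : ℕ → E) {B : Set E} (hB : MeasurableSet B) (t : ℝ≥0∞) :
    ∫⁻ ω, expNeg (t * ∑' i, finiteKernel E (configMeasure (C i ω)) ((fun z => x i + z) ⁻¹' B)) ∂P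
      = expNeg (∑' i, (1 - expNeg t) * ν ((fun z => x i + z) ⁻¹' B)) := by
  have hmeas (i : ℕ) :
      Measurable fun M => t * finiteKernel E M ((fun z => x i + z) ⁻¹' B) :=
    ((Kernel.measurable_coe _ (measurable_const_add _ hB)).const_mul t)
  simp_rw [← ENNReal.tsum_mul_left]
  refine lintegral_expNeg_tsum (h.daughter_indep.comp _ hmeas)
    (fun i => (hmeas i).comp (h.daughter i).measurable) fun i => ?_
  rw [← (h.daughter i).lintegral_expNeg_mul_count (measurable_const_add _ hB) (measure_ne_top ν _)]
  refine lintegral_congr_ae ?_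
  filter_upwards [h.ae_isFiniteMeasure_daughter] with ω hω
  have := hω i
  rw [Function.comp_apply, finiteKernel_of_isFiniteMeasure]

/-- Conditioning on the parents, the clusters contribute independent Poisson numbers of points, so
that the Laplace transform of the count becomes a Laplace functional of the parent process. -/
theorem lintegral_expNeg_mul_count [MeasurableNeg E] [MeasurableEq E] [NullSingletonClass ν]
    [IsFiniteMeasure ν] [SigmaFinite μ] (h : IsPoissonClustering X C μ ν P) {B : Set E}
    (hB : MeasurableSet B) (t : ℝ≥0∞) :
    ∫⁻ ω, expNeg (t * configMeasure (clusterUnion (X · ω) (C · ω)) B) ∂P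
      = expNeg (∫⁻ x, (1 - expNeg ((1 - expNeg t) * ν ((fun z => x + z) ⁻¹' B))) ∂μ) := by
  have hν : Measurable fun x => ν ((fun z => x + z) ⁻¹' B) :=
    measurable_measure_prodMk_left (measurable_add hB)
  calc ∫⁻ ω, expNeg (t * configMeasure (clusterUnion (X · ω) (C · ω)) B) ∂P
      = ∫⁻ ω, expNeg (t * ∑' i,
          finiteKernel E (configMeasure (C i ω)) ((fun z => X i ω + z) ⁻¹' B)) ∂P :=
        lintegral_congr_ae ((h.count_ae_eq_tsum hB).fun_comp fun u => expNeg (t * u))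
    _ = ∫⁻ ω, expNeg (∑' i, (1 - expNeg t) * ν ((fun z => X i ω + z) ⁻¹' B)) ∂P := by
        simp_rw [← h.lintegral_expNeg_mul_daughter _ hB]
        exact h.lintegral_comp_parent_daughter (measurable_expNeg.comp
          ((measurable_tsum_finiteKernel_preimage_add hB).const_mul t))
    _ = ∫⁻ ω, expNeg (∫⁻ x, (1 - expNeg t) * ν ((fun z => x + z) ⁻¹' B)
          ∂configMeasure (Set.range fun i => X i ω)) ∂P := by
        refine lintegral_congr_ae ?_
        filter_upwards [h.parent_injective] with ω hω
        rw [lintegral_configMeasure_range hω (hν.const_mul _)]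
    _ = _ := h.parent.lintegral_expNeg_lintegral (hν.const_mul _)

end IsPoissonClustering

section WeightedTuples

/-- The tuples `(b_1, …, b_M)` of natural numbers with `b_1 + 2 b_2 + ⋯ + M b_M = m`. Unlike in
`tupleSet`, their length does not depend on `m`, so that a recurrence in `m` can be stated. -/
def weightedTuples (M m : ℕ) : Finset (Fin M → ℕ) :=
  (Fintype.piFinset fun _ : Fin M => Finset.range (m + 1)).filter
    fun b => ∑ i : Fin M, ((i : ℕ) + 1) * b i = m

theorem succ_mul_le_sum_succ_mul {M : ℕ} (b : Fin M → ℕ) (i : Fin M) :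
    ((i : ℕ) + 1) * b i ≤ ∑ j : Fin M, ((j : ℕ) + 1) * b j :=
  Finset.single_le_sum (f := fun j : Fin M => ((j : ℕ) + 1) * b j)
    (fun _ _ => Nat.zero_le _) (Finset.mem_univ i)

theorem mem_weightedTuples {M m : ℕ} {b : Fin M → ℕ} :
    b ∈ weightedTuples M m ↔ ∑ i : Fin M, ((i : ℕ) + 1) * b i = m := by
  simp only [weightedTuples, Finset.mem_filter, Fintype.mem_piFinset, Finset.mem_range,
    and_iff_right_iff_imp]
  rintro rfl i
  exact Nat.lt_succ_of_le <|
    (Nat.le_mul_of_pos_left _ (Nat.succ_pos i)).trans (succ_mul_le_sum_succ_mul b i)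

theorem weightedTuples_zero_right (M : ℕ) : weightedTuples M 0 = {0} := by
  ext b
  simp [mem_weightedTuples, funext_iff]

variable {𝕜 : Type*} [Field 𝕜]

/-- The contribution `∏ a_i ^ b_i / b_i!` of the tuple `b` to the coefficients of
`exp (∑ a_i s^i)`. -/
def tupleWeight (a : ℕ → 𝕜) {M : ℕ} (b : Fin M → ℕ) : 𝕜 :=
  ∏ i : Fin M, a ((i : ℕ) + 1) ^ b i / (b i).factorial

/-- The coefficient of `s^m` in the power series `exp (∑ a_j s^j)`, the sum being over `j ≥ 1`. -/
def expCoeff (a : ℕ → 𝕜) (m : ℕ) : 𝕜 := ∑ b ∈ tupleSet m, tupleWeight a b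

theorem expCoeff_congr {a a' : ℕ → 𝕜} (h : ∀ i, a (i + 1) = a' (i + 1)) (m : ℕ) :
    expCoeff a m = expCoeff a' m := by
  simp only [expCoeff, tupleWeight, h]

theorem sum_succ_mul_add_single {M : ℕ} (b : Fin M → ℕ) (i : Fin M) :
    ∑ j : Fin M, ((j : ℕ) + 1) * (b + Pi.single i 1 : Fin M → ℕ) j
      = ∑ j : Fin M, ((j : ℕ) + 1) * b j + (i + 1) := by
  simp [mul_add, Finset.sum_add_distrib, Pi.single_apply]

variable [CharZero 𝕜]

theorem add_one_mul_tupleWeight_add_single (a : ℕ → 𝕜) {M : ℕ} (b : Fin M → ℕ) (i : Fin M) :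
    (b i + 1 : 𝕜) * tupleWeight a (b + Pi.single i 1) = a ((i : ℕ) + 1) * tupleWeight a b := by
  have hfactor (j : Fin M) :
      a ((j : ℕ) + 1) ^ (b + Pi.single i 1 : Fin M → ℕ) j
          / ((b + Pi.single i 1 : Fin M → ℕ) j).factorial
        = a ((j : ℕ) + 1) ^ b j / (b j).factorial
          * if j = i then a ((i : ℕ) + 1) / (b i + 1) else 1 := by
    rcases eq_or_ne j i with rfl | hj
    · simp only [Pi.add_apply, Pi.single_eq_same, Nat.factorial_succ, pow_succ, Nat.cast_mul,
        Nat.cast_add, Nat.cast_one, if_true]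
      field_simp
    · simp [hj]
  have hb : (b i + 1 : 𝕜) ≠ 0 := by exact_mod_cast (b i).succ_ne_zero
  simp only [tupleWeight, hfactor, Finset.prod_mul_distrib, Finset.prod_ite_eq', Finset.mem_univ,
    if_true]
  field_simp

theorem sum_weightedTuples_apply_mul_tupleWeight (a : ℕ → 𝕜) {M : ℕ} (m : ℕ) (i : Fin M) :
    ∑ b ∈ weightedTuples M (m + (i + 1)), (b i : 𝕜) * tupleWeight a b
      = a ((i : ℕ) + 1) * ∑ b ∈ weightedTuples M m, tupleWeight a b := by
  rw [Finset.mul_sum]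
  refine (Finset.sum_of_injOn (· + Pi.single i 1) (add_left_injective _).injOn (fun b hb => ?_)
    (fun b hb hb' => ?_) fun b _ => ?_).symm
  · simp only [Finset.mem_coe, mem_weightedTuples] at hb ⊢
    rw [sum_succ_mul_add_single, hb]
  · suffices hbi : b i = 0 by simp [hbi]
    by_contra hbi
    have hsub : b - Pi.single i 1 + Pi.single i 1 = b := tsub_add_cancel_of_le fun j => by
      rcases eq_or_ne j i with rfl | hj
      · simpa using Nat.one_le_iff_ne_zero.2 hbi
      · simp [hj]
    refine hb' ⟨b - Pi.single i 1, ?_, hsub⟩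
    rw [mem_weightedTuples, ← hsub, sum_succ_mul_add_single] at hb
    exact mem_weightedTuples.2 (Nat.add_right_cancel hb)
  · rw [← add_one_mul_tupleWeight_add_single]
    simp

theorem add_one_mul_sum_weightedTuples_succ (a : ℕ → 𝕜) {M m : ℕ} (hm : m < M) :
    (m + 1 : 𝕜) * ∑ b ∈ weightedTuples M (m + 1), tupleWeight a b
      = ∑ i ∈ Finset.range (m + 1),
          (i + 1 : 𝕜) * a (i + 1) * ∑ b ∈ weightedTuples M (m - i), tupleWeight a b := by
  have hsum (b : Fin M → ℕ) (hb : b ∈ weightedTuples M (m + 1)) :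
      (m + 1 : 𝕜) * tupleWeight a b
        = ∑ i : Fin M, ((i : ℕ) + 1 : 𝕜) * ((b i : 𝕜) * tupleWeight a b) := by
    have hweight : (∑ i : Fin M, ((i : ℕ) + 1 : 𝕜) * b i) = m + 1 := by
      exact_mod_cast mem_weightedTuples.1 hb
    simp_rw [← hweight, Finset.sum_mul, mul_assoc]
  have hlarge (i : Fin M) (hi : m < i) :
      ∑ b ∈ weightedTuples M (m + 1), (b i : 𝕜) * tupleWeight a b = 0 := by
    refine Finset.sum_eq_zero fun b hb => ?_
    have hle := mem_weightedTuples.1 hb ▸ succ_mul_le_sum_succ_mul b i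
    have hbi : b i = 0 := by
      by_contra hbi
      have := Nat.le_mul_of_pos_right ((i : ℕ) + 1) (Nat.pos_of_ne_zero hbi)
      omega
    simp [hbi]
  have hsmall (i : Fin (m + 1)) :
      ∑ b ∈ weightedTuples M (m + 1), (b (Fin.castLE hm i) : 𝕜) * tupleWeight a b
        = a (i + 1) * ∑ b ∈ weightedTuples M (m - i), tupleWeight a b := by
    have := sum_weightedTuples_apply_mul_tupleWeight a (m - i) (Fin.castLE hm i)
    rwa [Fin.val_castLE, show m - (i : ℕ) + (i + 1) = m + 1 by omega] at this
  rw [Finset.mul_sum, Finset.sum_congr rfl hsum, Finset.sum_comm, Finset.sum_range]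
  simp_rw [← Finset.mul_sum]
  refine (Finset.sum_of_injOn (Fin.castLE hm) (Fin.castLE_injective hm).injOn
    (fun _ _ => Finset.mem_coe.2 (Finset.mem_univ _)) (fun i _ hi => ?_) fun i _ => ?_).symm
  · rw [hlarge i, mul_zero]
    by_contra! hle
    exact hi ⟨⟨i, by omega⟩, by simp, rfl⟩
  · rw [hsmall, Fin.val_castLE, mul_assoc]

theorem eq_mul_expCoeff_of_recurrence {p a : ℕ → 𝕜}
    (hrec : ∀ m : ℕ, (m + 1 : 𝕜) * p (m + 1)
      = ∑ i ∈ Finset.range (m + 1), (i + 1 : 𝕜) * a (i + 1) * p (m - i)) (M : ℕ) :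
    p M = p 0 * expCoeff a M := by
  suffices h : ∀ m ≤ M, p m = p 0 * ∑ b ∈ weightedTuples M m, tupleWeight a b from h M le_rfl
  intro m
  induction m using Nat.strong_induction_on with
  | _ m ih =>
    intro hm
    rcases m with _ | m
    · simp [weightedTuples_zero_right, tupleWeight]
    · have hm0 : (m + 1 : 𝕜) ≠ 0 := by exact_mod_cast m.succ_ne_zero
      refine mul_left_cancel₀ hm0 ?_
      rw [hrec, mul_left_comm, add_one_mul_sum_weightedTuples_succ a hm, Finset.mul_sum]
      refine Finset.sum_congr rfl fun i _ => ?_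
      rw [ih (m - i) (by omega) (by omega)]
      ring

end WeightedTuples

section PowerSeries

theorem hasFPowerSeriesAt_ofScalars_of_hasSum {c : ℕ → ℝ} {f : ℝ → ℝ}
    (h : ∀ᶠ s in 𝓝 (0 : ℝ), HasSum (fun m => c m * s ^ m) (f s)) :
    HasFPowerSeriesAt f (FormalMultilinearSeries.ofScalars ℝ c) 0 := by
  rw [hasFPowerSeriesAt_iff]
  filter_upwards [h] with s hs
  simpa [mul_comm] using hs

theorem iteratedDeriv_eq_of_hasSum {c : ℕ → ℝ} {f : ℝ → ℝ}
    (h : ∀ᶠ s in 𝓝 (0 : ℝ), HasSum (fun m => c m * s ^ m) (f s)) (m : ℕ) :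
    iteratedDeriv m f 0 = m.factorial * c m := by
  have hf := hasFPowerSeriesAt_ofScalars_of_hasSum h
  have hcoeff := congrArg (fun q => FormalMultilinearSeries.coeff q m)
    (hf.eq_formalMultilinearSeries hf.analyticAt.hasFPowerSeriesAt)
  simp only [FormalMultilinearSeries.coeff_ofScalars] at hcoeff
  rw [hcoeff]
  field_simp

theorem iteratedDeriv_succ_of_deriv_eventuallyEq_mul {G K : ℝ → ℝ} {x : ℝ}
    (hG : AnalyticAt ℝ G x) (hK : AnalyticAt ℝ K x) (h : deriv G =ᶠ[𝓝 x] K * G) (m : ℕ) :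
    iteratedDeriv (m + 1) G x = ∑ i ∈ Finset.range (m + 1),
      m.choose i * iteratedDeriv i K x * iteratedDeriv (m - i) G x := by
  rw [iteratedDeriv_succ', h.iteratedDeriv_eq m, iteratedDeriv_mul hK.contDiffAt hG.contDiffAt]

theorem add_one_mul_coeff_succ_of_deriv_eventuallyEq {p a : ℕ → ℝ} {G H : ℝ → ℝ}
    (hG : ∀ᶠ s in 𝓝 (0 : ℝ), HasSum (fun m => p m * s ^ m) (G s))
    (hH : ∀ᶠ s in 𝓝 (0 : ℝ), HasSum (fun m => a m * s ^ m) (H s))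
    (hd : deriv G =ᶠ[𝓝 0] deriv H * G) (m : ℕ) :
    (m + 1 : ℝ) * p (m + 1)
      = ∑ i ∈ Finset.range (m + 1), (i + 1 : ℝ) * a (i + 1) * p (m - i) := by
  have hderiv := iteratedDeriv_succ_of_deriv_eventuallyEq_mul
    (hasFPowerSeriesAt_ofScalars_of_hasSum hG).analyticAt
    (hasFPowerSeriesAt_ofScalars_of_hasSum hH).analyticAt.deriv hd m
  simp_rw [← iteratedDeriv_succ', iteratedDeriv_eq_of_hasSum hG,
    iteratedDeriv_eq_of_hasSum hH] at hderiv
  refine mul_left_cancel₀ (show (m.factorial : ℝ) ≠ 0 by positivity) ?_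
  calc (m.factorial : ℝ) * ((m + 1) * p (m + 1)) = (m + 1).factorial * p (m + 1) := by
        push_cast [Nat.factorial_succ]
        ring
    _ = _ := hderiv
    _ = _ := by
        rw [Finset.mul_sum]
        refine Finset.sum_congr rfl fun i hi => ?_
        rw [← Nat.choose_mul_factorial_mul_factorial (Finset.mem_range_succ_iff.1 hi),
          Nat.factorial_succ]
        push_cast
        ring

theorem coeff_eq_exp_mul_expCoeff {p a : ℕ → ℝ} {G H : ℝ → ℝ}
    (hG : ∀ᶠ s in 𝓝 (0 : ℝ), HasSum (fun m => p m * s ^ m) (G s))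
    (hH : ∀ᶠ s in 𝓝 (0 : ℝ), HasSum (fun m => a m * s ^ m) (H s))
    (hGH : ∀ᶠ s in 𝓝[>] (0 : ℝ), G s = Real.exp (H s)) (m : ℕ) :
    p m = Real.exp (a 0) * expCoeff a m := by
  have hGa := (hasFPowerSeriesAt_ofScalars_of_hasSum hG).analyticAt
  have hHa := (hasFPowerSeriesAt_ofScalars_of_hasSum hH).analyticAt
  have hev : G =ᶠ[𝓝 0] fun s => Real.exp (H s) :=
    (hGa.frequently_eq_iff_eventually_eq hHa.rexp).1 <|
      hGH.frequently.filter_mono (nhdsWithin_mono _ fun s hs => ne_of_gt hs)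
  have hp0 : p 0 = Real.exp (a 0) := by
    have hG0 : G 0 = p 0 := by simpa using iteratedDeriv_eq_of_hasSum hG 0
    have hH0 : H 0 = a 0 := by simpa using iteratedDeriv_eq_of_hasSum hH 0
    rw [← hG0, ← hH0, hev.eq_of_nhds]
  have hd : deriv G =ᶠ[𝓝 0] deriv H * G := by
    filter_upwards [hev.eventuallyEq_nhds, hHa.eventually_analyticAt] with s hs hHs
    rw [hs.deriv_eq, Pi.mul_apply, hs.eq_of_nhds, mul_comm,
      hHs.differentiableAt.hasDerivAt.exp.deriv]
  rw [← hp0]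
  exact eq_mul_expCoeff_of_recurrence
    (add_one_mul_coeff_succ_of_deriv_eventuallyEq hG hH hd) m

end PowerSeries

section PoissonMixture

/-- The excess of the Poisson distribution of mean `u` over the Dirac mass at `0`, evaluated
at `j`. -/
def poissonExcess (j : ℕ) (u : ℝ) : ℝ := u ^ j / j.factorial * Real.exp (-u) - 0 ^ j

theorem poissonExcess_zero (u : ℝ) : poissonExcess 0 u = Real.exp (-u) - 1 := by
  simp [poissonExcess]

theorem poissonExcess_succ (j : ℕ) (u : ℝ) :
    poissonExcess (j + 1) u = u ^ (j + 1) / (j + 1).factorial * Real.exp (-u) := by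
  simp [poissonExcess]

theorem poissonExcess_apply_zero (j : ℕ) : poissonExcess j 0 = 0 := by
  rcases j with _ | j <;> simp [poissonExcess]

@[fun_prop] theorem measurable_poissonExcess (j : ℕ) : Measurable (poissonExcess j) := by
  unfold poissonExcess
  fun_prop

theorem hasSum_zero_pow_mul_pow (s : ℝ) : HasSum (fun j : ℕ => 0 ^ j * s ^ j) 1 := by
  simpa using hasSum_single (f := fun j : ℕ => 0 ^ j * s ^ j) 0 fun j hj => by simp [hj]

theorem hasSum_poissonExcess_mul_pow (u s : ℝ) :
    HasSum (fun j => poissonExcess j u * s ^ j) (Real.exp (-((1 - s) * u)) - 1) := by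
  simpa only [poissonExcess, sub_mul] using
    (hasSum_pow_div_factorial_mul_exp_neg u s).sub (hasSum_zero_pow_mul_pow s)

theorem hasSum_abs_poissonExcess {u : ℝ} (hu : 0 ≤ u) :
    HasSum (fun j => |poissonExcess j u|) (2 * (1 - Real.exp (-u))) := by
  have habs (j : ℕ) : |poissonExcess j u|
      = poissonExcess j u * 1 ^ j + 2 * (1 - Real.exp (-u)) * (0 ^ j * 1 ^ j) := by
    rcases j with _ | j
    · rw [poissonExcess_zero, abs_of_nonpos (by simpa using hu)]
      ring
    · rw [poissonExcess_succ, abs_of_nonneg (by positivity)]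
      simp
  simp_rw [habs]
  simpa using (hasSum_poissonExcess_mul_pow u 1).add
    ((hasSum_zero_pow_mul_pow 1).mul_left (2 * (1 - Real.exp (-u))))

variable {E : Type*} [MeasurableSpace E] {μ : Measure E} {g : E → ℝ}

/-- If each point `x` of a Poisson process of intensity `μ` carries an independent Poisson number
of mean `g x`, then for `j ≥ 1` this is the expected number of points that carry the number `j`.
For `j = 0` the total mass of `μ`, which may be infinite, is subtracted from that expectation. -/
def poissonMixtureCoeff (μ : Measure E) (g : E → ℝ) (j : ℕ) : ℝ := ∫ x, poissonExcess j (g x) ∂μ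

theorem integrable_one_sub_exp_neg (hg : Integrable g μ) (hg0 : 0 ≤ g) :
    Integrable (fun x => 1 - Real.exp (-g x)) μ := by
  refine hg.mono' (by have := hg.aestronglyMeasurable; fun_prop) (ae_of_all _ fun x => ?_)
  rw [Real.norm_of_nonneg (by simpa using hg0 x)]
  linarith [Real.add_one_le_exp (-g x)]

theorem hasSum_poissonMixtureCoeff_mul_pow (hg : Integrable g μ) (hg0 : 0 ≤ g) {s : ℝ}
    (hs : |s| ≤ 1) : HasSum (fun j => poissonMixtureCoeff μ g j * s ^ j)
      (∫ x, (Real.exp (-((1 - s) * g x)) - 1) ∂μ) := by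
  have hmeas (j : ℕ) : AEStronglyMeasurable (fun x => poissonExcess j (g x) * s ^ j) μ :=
    (((measurable_poissonExcess j).comp_aemeasurable hg.aemeasurable).mul_const
      _).aestronglyMeasurable
  simp_rw [poissonMixtureCoeff, ← integral_mul_const]
  refine hasSum_integral_of_dominated_convergence (fun j x => |poissonExcess j (g x)|) hmeas
    (fun j => ae_of_all _ fun x => ?_)
    (ae_of_all _ fun x => (hasSum_abs_poissonExcess (hg0 x)).summable) ?_
    (ae_of_all _ fun x => hasSum_poissonExcess_mul_pow (g x) s)
  · rw [norm_mul, norm_pow]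
    exact mul_le_of_le_one_right (norm_nonneg _) (pow_le_one₀ (norm_nonneg s) hs)
  · simp_rw [fun x => (hasSum_abs_poissonExcess (hg0 x)).tsum_eq]
    exact (integrable_one_sub_exp_neg hg hg0).const_mul 2

theorem expNeg_lintegral_one_sub_expNeg (hg : Integrable g μ) (hg0 : 0 ≤ g) :
    expNeg (∫⁻ x, (1 - expNeg (ENNReal.ofReal (g x))) ∂μ)
      = ENNReal.ofReal (Real.exp (∫ x, (Real.exp (-g x) - 1) ∂μ)) := by
  have hnonneg (x : E) : 0 ≤ 1 - Real.exp (-g x) := by simpa using hg0 x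
  simp_rw [fun x => one_sub_expNeg_ofReal (hg0 x)]
  rw [← ofReal_integral_eq_lintegral_ofReal (integrable_one_sub_exp_neg hg hg0)
    (ae_of_all _ hnonneg), expNeg_ofReal (integral_nonneg hnonneg), ← integral_neg]
  simp_rw [neg_sub]

end PoissonMixture

section CountLaw

theorem ae_lt_top_of_expNeg_le_lintegral {Ω : Type*} [MeasurableSpace Ω] {P : Measure Ω}
    [IsProbabilityMeasure P] {N : Ω → ℝ≥0∞} (hN : AEMeasurable N P) {G : ℝ≥0∞} (hG : G ≠ ∞)
    (h : ∀ t : ℝ≥0∞, expNeg ((1 - expNeg t) * G) ≤ ∫⁻ ω, expNeg (t * N ω) ∂P) :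
    ∀ᵐ ω ∂P, N ω < ∞ := by
  have hnull : NullMeasurableSet {ω | N ω < ∞} P := nullMeasurableSet_lt hN aemeasurable_const
  have hle (t : ℝ≥0∞) (ht : t ≠ 0) : expNeg ((1 - expNeg t) * G) ≤ P {ω | N ω < ∞} := by
    refine (h t).trans ((lintegral_mono fun ω => ?_).trans_eq (lintegral_indicator_one₀ hnull))
    rcases eq_or_ne (N ω) ∞ with hω | hω
    · simp [hω, ENNReal.mul_top ht]
    · simpa [hω, hω.lt_top] using expNeg_le_one _
  have hlim : Tendsto (fun t => expNeg ((1 - expNeg t) * G)) (𝓝[>] 0) (𝓝 1) := by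
    have hcont : Continuous fun t => expNeg ((1 - expNeg t) * G) :=
      continuous_expNeg.comp <| (ENNReal.continuous_mul_const hG).comp <|
        (ENNReal.continuous_sub_left ENNReal.one_ne_top).comp continuous_expNeg
    simpa using (hcont.tendsto 0).mono_left nhdsWithin_le_nhds
  have hone : P {ω | N ω < ∞} = 1 := le_antisymm prob_le_one <|
    le_of_tendsto hlim <| eventually_mem_nhdsWithin.mono fun t ht => hle t (ne_of_gt ht)
  exact (prob_compl_eq_zero_iff₀ hnull).2 hone

theorem measureReal_singleton_eq_exp_mul_expCoeff {p : Measure ℕ} [IsProbabilityMeasure p]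
    {a : ℕ → ℝ} {H : ℝ → ℝ} (hH : ∀ᶠ s in 𝓝 (0 : ℝ), HasSum (fun j => a j * s ^ j) (H s))
    (hp : ∀ᶠ s in 𝓝[>] (0 : ℝ), ∫ j, s ^ j ∂p = Real.exp (H s)) (m : ℕ) :
    p.real {m} = Real.exp (a 0) * expCoeff a m := by
  have hsum (s : ℝ) (hs : |s| < 1) : HasSum (fun j => p.real {j} * s ^ j) (∫ j, s ^ j ∂p) := by
    have hint : Integrable (fun j : ℕ => s ^ j) p :=
      .of_bound (by fun_prop) 1 <| ae_of_all _ fun j => by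
        simpa using pow_le_one₀ (abs_nonneg s) hs.le
    rw [integral_countable hint]
    simp_rw [smul_eq_mul]
    refine (Summable.of_norm_bounded (summable_geometric_of_abs_lt_one
      (r := |s|) (by rwa [abs_abs])) fun j => ?_).hasSum
    rw [norm_mul, norm_pow, Real.norm_eq_abs s, Real.norm_of_nonneg measureReal_nonneg]
    exact mul_le_of_le_one_left (by positivity) measureReal_le_one
  refine coeff_eq_exp_mul_expCoeff (p := fun j => p.real {j}) ?_ hH hp m
  filter_upwards [Ioo_mem_nhds (neg_one_lt_zero : (-1 : ℝ) < 0) one_pos] with s hs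
  exact hsum s (abs_lt.2 hs)

theorem measureReal_Ici_eq_one_sub {p : Measure ℕ} [IsProbabilityMeasure p]
    {a : ℕ → ℝ} {H : ℝ → ℝ} (hH : ∀ᶠ s in 𝓝 (0 : ℝ), HasSum (fun j => a j * s ^ j) (H s))
    (hp : ∀ᶠ s in 𝓝[>] (0 : ℝ), ∫ j, s ^ j ∂p = Real.exp (H s)) (k : ℕ) :
    p.real (Set.Ici k) = 1 - Real.exp (a 0) * ∑ m ∈ Finset.range k, expCoeff a m := by
  have hcompl : (Set.Ici k : Set ℕ) = (Finset.range k : Set ℕ)ᶜ := by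
    ext; simp
  rw [hcompl, probReal_compl_eq_one_sub (Finset.measurableSet _), ← sum_measureReal_singleton,
    Finset.mul_sum]
  simp_rw [measureReal_singleton_eq_exp_mul_expCoeff hH hp]

theorem measureReal_natCast_le_eq_one_sub {Ω : Type*} [MeasurableSpace Ω] {P : Measure Ω}
    [IsProbabilityMeasure P] {N : Ω → ℝ≥0∞} (hN : AEMeasurable N P)
    (hnat : ∀ᵐ ω ∂P, ∃ j : ℕ, N ω = j) {a : ℕ → ℝ} {H : ℝ → ℝ}
    (hH : ∀ᶠ s in 𝓝 (0 : ℝ), HasSum (fun j => a j * s ^ j) (H s))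
    (hNH : ∀ t : ℝ, 0 ≤ t → ∫⁻ ω, expNeg (ENNReal.ofReal t * N ω) ∂P
      = ENNReal.ofReal (Real.exp (H (Real.exp (-t))))) (k : ℕ) :
    P.real {ω | (k : ℝ≥0∞) ≤ N ω}
      = 1 - Real.exp (a 0) * ∑ m ∈ Finset.range k, expCoeff a m := by
  set D : Ω → ℕ := fun ω => ⌊(N ω).toReal⌋₊
  have hD : AEMeasurable D P := Nat.measurable_floor.comp_aemeasurable hN.ennreal_toReal
  have hND : ∀ᵐ ω ∂P, N ω = D ω := by
    filter_upwards [hnat] with ω ⟨j, hj⟩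
    simp [D, hj]
  have := Measure.isProbabilityMeasure_map hD
  have hgen : ∀ᶠ s in 𝓝[>] (0 : ℝ), ∫ j, s ^ j ∂(P.map D) = Real.exp (H s) := by
    filter_upwards [Ioo_mem_nhdsGT (one_pos : (0 : ℝ) < 1)] with s ⟨hs0, hs1⟩
    have ht : 0 ≤ -Real.log s := neg_nonneg.2 (Real.log_nonpos hs0.le hs1.le)
    have hts : Real.exp (-(-Real.log s)) = s := by rw [neg_neg, Real.exp_log hs0]
    have hpow : ∀ᵐ ω ∂P,
        expNeg (ENNReal.ofReal (-Real.log s) * N ω) = ENNReal.ofReal (s ^ D ω) := by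
      filter_upwards [hND] with ω hω
      rw [hω, expNeg_mul_natCast, expNeg_ofReal ht, hts, ENNReal.ofReal_pow hs0.le]
    rw [integral_map hD (by fun_prop), integral_eq_lintegral_of_nonneg_ae
      (ae_of_all _ fun ω => pow_nonneg hs0.le _) (by fun_prop), ← lintegral_congr_ae hpow,
      hNH _ ht, hts, ENNReal.toReal_ofReal (Real.exp_nonneg _)]
  rw [← measureReal_Ici_eq_one_sub hH hgen k,
    map_measureReal_apply_of_aemeasurable hD measurableSet_Ici]
  refine measureReal_congr ?_
  filter_upwards [hND] with ω hω
  refine propext ?_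
  change (k : ℝ≥0∞) ≤ N ω ↔ k ≤ D ω
  rw [hω, Nat.cast_le]

end CountLaw

section ClusterCount

theorem exists_configMeasure_eq_natCast {E : Type*} [MeasurableSpace E] {S B : Set E}
    (hB : MeasurableSet B) (h : configMeasure S B < ∞) : ∃ j : ℕ, configMeasure S B = j := by
  rw [configMeasure_apply S hB] at h ⊢
  obtain ⟨j, hj⟩ := ENat.ne_top_iff_exists.1 (ENat.toENNReal_lt_top.1 h).ne
  exact ⟨j, by rw [← hj, ENat.toENNReal_coe]⟩

namespace IsPoissonClustering

variable {Ω E : Type*} [MeasurableSpace Ω] [MeasurableSpace E] [AddGroup E] [MeasurableAdd₂ E]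
  [MeasurableNeg E] [MeasurableEq E] {X : ℕ → Ω → E} {C : ℕ → Ω → Set E} {μ ν : Measure E}
  {P : Measure Ω} [NullSingletonClass ν] [IsFiniteMeasure ν] [SigmaFinite μ] {B : Set E}

theorem ae_count_lt_top (h : IsPoissonClustering X C μ ν P) (hB : MeasurableSet B) {g : E → ℝ}
    (hg : ∀ x, ν.real ((fun z => x + z) ⁻¹' B) = g x) (hgint : Integrable g μ) :
    ∀ᵐ ω ∂P, configMeasure (clusterUnion (X · ω) (C · ω)) B < ∞ := by
  have := h.isProbabilityMeasure
  have hν : Measurable fun x => ν ((fun z => x + z) ⁻¹' B) :=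
    measurable_measure_prodMk_left (measurable_add hB)
  have hmean := hgint.lintegral_lt_top.ne
  simp_rw [← hg, ofReal_measureReal (measure_ne_top ν _)] at hmean
  refine ae_lt_top_of_expNeg_le_lintegral (h.aemeasurable_count hB) hmean fun t => ?_
  rw [h.lintegral_expNeg_mul_count hB, ← lintegral_const_mul _ hν]
  exact antitone_expNeg (lintegral_mono fun x => one_sub_expNeg_le _)

theorem lintegral_expNeg_ofReal_mul_count (h : IsPoissonClustering X C μ ν P)
    (hB : MeasurableSet B) {g : E → ℝ} (hg : ∀ x, ν.real ((fun z => x + z) ⁻¹' B) = g x)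
    (hgint : Integrable g μ) {t : ℝ} (ht : 0 ≤ t) :
    ∫⁻ ω, expNeg (ENNReal.ofReal t * configMeasure (clusterUnion (X · ω) (C · ω)) B) ∂P
      = ENNReal.ofReal
          (Real.exp (∫ x, (Real.exp (-((1 - Real.exp (-t)) * g x)) - 1) ∂μ)) := by
  have hs : 0 ≤ 1 - Real.exp (-t) := by simpa using ht
  have hg0 (x : E) : 0 ≤ g x := hg x ▸ measureReal_nonneg
  have harg (x : E) : (1 - expNeg (ENNReal.ofReal t)) * ν ((fun z => x + z) ⁻¹' B)
      = ENNReal.ofReal ((1 - Real.exp (-t)) * g x) := by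
    rw [one_sub_expNeg_ofReal ht, ENNReal.ofReal_mul hs, ← hg, ofReal_measureReal]
  rw [h.lintegral_expNeg_mul_count hB]
  simp_rw [harg]
  exact expNeg_lintegral_one_sub_expNeg (hgint.const_mul _) fun x => mul_nonneg hs (hg0 x)

theorem measureReal_natCast_le_count (h : IsPoissonClustering X C μ ν P) (hB : MeasurableSet B)
    {g : E → ℝ} (hg : ∀ x, ν.real ((fun z => x + z) ⁻¹' B) = g x) (hgint : Integrable g μ)
    (k : ℕ) :
    P.real {ω | (k : ℝ≥0∞) ≤ configMeasure (clusterUnion (X · ω) (C · ω)) B}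
      = 1 - Real.exp (poissonMixtureCoeff μ g 0)
          * ∑ m ∈ Finset.range k, expCoeff (poissonMixtureCoeff μ g) m := by
  have := h.isProbabilityMeasure
  have hg0 (x : E) : 0 ≤ g x := hg x ▸ measureReal_nonneg
  refine measureReal_natCast_le_eq_one_sub
    (H := fun s => ∫ x, (Real.exp (-((1 - s) * g x)) - 1) ∂μ) (h.aemeasurable_count hB)
    ((h.ae_count_lt_top hB hg hgint).mono fun ω => exists_configMeasure_eq_natCast hB) ?_
    (fun t ht => h.lintegral_expNeg_ofReal_mul_count hB hg hgint ht) k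
  filter_upwards [Ioo_mem_nhds (neg_one_lt_zero : (-1 : ℝ) < 0) one_pos] with s hs
  exact hasSum_poissonMixtureCoeff_mul_pow hgint hg0 (abs_le.2 ⟨hs.1.le, hs.2.le⟩)

end IsPoissonClustering

end ClusterCount

section KthDist

variable {E : Type*} [PseudoMetricSpace E] {S : Set E} {y : E} {k : ℕ}

theorem eventually_nhdsGT_inter_closedBall_eq {r : ℝ}
    (hS : (S ∩ Metric.closedBall y (r + 1)).Finite) :
    ∀ᶠ ρ in 𝓝[>] r, S ∩ Metric.closedBall y ρ = S ∩ Metric.closedBall y r := by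
  have hdist : ∀ᶠ ρ in 𝓝[>] r,
      ∀ z ∈ S ∩ Metric.closedBall y (r + 1), dist z y ≤ ρ → dist z y ≤ r := by
    refine (eventually_all_finite hS).2 fun z _ => ?_
    rcases le_or_gt (dist z y) r with hz | hz
    · exact Eventually.of_forall fun _ _ => hz
    · filter_upwards [Ioo_mem_nhdsGT hz] with ρ hρ hzρ using absurd hzρ hρ.2.not_ge
  filter_upwards [hdist, Ioo_mem_nhdsGT (lt_add_one r)] with ρ hρ ⟨hr, hr1⟩
  refine Set.Subset.antisymm (fun z hz => ⟨hz.1, hρ z ⟨hz.1, ?_⟩ hz.2⟩)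
    (Set.inter_subset_inter_right S (Metric.closedBall_subset_closedBall hr.le))
  exact Metric.closedBall_subset_closedBall hr1.le hz.2

theorem kthDist_le_coe_iff_encard (hS : ∀ ρ : ℝ, (S ∩ Metric.closedBall y ρ).Finite) (r : ℝ≥0) :
    kthDist k y S ≤ r ↔ (k : ℕ∞) ≤ (S ∩ Metric.closedBall y r).encard := by
  refine ⟨fun h => ?_, fun h => iInf₂_le r h⟩
  obtain ⟨R, hrR, hR⟩ := mem_nhdsGT_iff_exists_Ioo_subset.1
    (eventually_nhdsGT_inter_closedBall_eq (hS ((r : ℝ) + 1)))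
  have hlt : kthDist k y S < ENNReal.ofReal R :=
    h.trans_lt ((ENNReal.lt_ofReal_iff_toReal_lt ENNReal.coe_ne_top).2 hrR)
  simp only [kthDist, iInf_lt_iff] at hlt
  obtain ⟨ρ, hkρ, hρR⟩ := hlt
  rcases le_or_gt ρ r with hρr | hρr
  · exact hkρ.trans (Set.encard_le_encard (Set.inter_subset_inter_right S
      (Metric.closedBall_subset_closedBall hρr)))
  · have hρ : (ρ : ℝ) < R := (ENNReal.lt_ofReal_iff_toReal_lt ENNReal.coe_ne_top).1 hρR
    rwa [← show _ = _ from hR ⟨hρr, hρ⟩]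

variable [MeasurableSpace E] {Ω : Type*} [MeasurableSpace Ω] {P : Measure Ω} {Φ : Ω → Set E}

theorem ae_count_closedBall_lt_top
    (h : ∀ ρ : ℝ, ∀ᵐ ω ∂P, configMeasure (Φ ω) (Metric.closedBall y ρ) < ∞) :
    ∀ᵐ ω ∂P, ∀ ρ : ℝ, configMeasure (Φ ω) (Metric.closedBall y ρ) < ∞ := by
  filter_upwards [ae_all_iff.2 fun m : ℕ => h m] with ω hω ρ
  obtain ⟨m, hm⟩ := exists_nat_ge ρ
  exact (measure_mono (Metric.closedBall_subset_closedBall hm)).trans_lt (hω m)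

variable [OpensMeasurableSpace E]

theorem kthDist_le_coe_iff (hS : ∀ ρ : ℝ, configMeasure S (Metric.closedBall y ρ) < ∞) (r : ℝ≥0) :
    kthDist k y S ≤ r ↔ (k : ℝ≥0∞) ≤ configMeasure S (Metric.closedBall y r) := by
  simp only [configMeasure_apply S measurableSet_closedBall, ENat.toENNReal_lt_top,
    Set.encard_lt_top_iff] at hS
  rw [kthDist_le_coe_iff_encard hS, configMeasure_apply S measurableSet_closedBall,
    ← ENat.toENNReal_coe, ENat.toENNReal_le]

theorem aemeasurable_kthDist
    (hmeas : ∀ r : ℝ, AEMeasurable (fun ω => configMeasure (Φ ω) (Metric.closedBall y r)) P)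
    (hfin : ∀ᵐ ω ∂P, ∀ ρ : ℝ, configMeasure (Φ ω) (Metric.closedBall y ρ) < ∞) :
    AEMeasurable (fun ω => kthDist k y (Φ ω)) P := by
  refine NullMeasurable.aemeasurable (measurable_of_Iic
    (f := fun ω : NullMeasurableSpace Ω P => kthDist k y (Φ ω)) fun t => ?_)
  change NullMeasurableSet {ω | kthDist k y (Φ ω) ≤ t} P
  induction t with
  | top => simp
  | coe r =>
    refine (nullMeasurableSet_le (aemeasurable_const (b := (k : ℝ≥0∞))) (hmeas r)).congr ?_
    filter_upwards [hfin] with ω hω using propext (kthDist_le_coe_iff hω r).symm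

end KthDist

section Volume

variable (n : ℕ) [NeZero n]

theorem volume_real_unitBall :
    (volume : Measure (EuclideanSpace ℝ (Fin n))).real (Metric.ball 0 1) = unitBallVolume n := by
  have : 0 < Real.Gamma ((n : ℝ) / 2 + 1) := Real.Gamma_pos_of_pos (by positivity)
  rw [Measure.real, EuclideanSpace.volume_ball, ENNReal.ofReal_one, one_pow, one_mul,
    ENNReal.toReal_ofReal (by positivity), unitBallVolume, Fintype.card_fin,
    Real.sqrt_eq_rpow, ← Real.rpow_natCast, ← Real.rpow_mul Real.pi_pos.le]
  congr 2
  ring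

theorem exists_linearIsometryEquiv_eq {E : Type*} [NormedAddCommGroup E] [InnerProductSpace ℝ E]
    {v w : E} (h : ‖v‖ = ‖w‖) : ∃ T : E ≃ₗᵢ[ℝ] E, T v = w :=
  ⟨_, Submodule.reflection_sub h⟩

theorem volume_real_closedBall_inter_closedBall (r rd : ℝ) (v : EuclideanSpace ℝ (Fin n)) :
    (volume : Measure (EuclideanSpace ℝ (Fin n))).real
      (Metric.closedBall v r ∩ Metric.closedBall 0 rd) = interVolume n r rd ‖v‖ := by
  obtain ⟨T, hT⟩ := exists_linearIsometryEquiv_eq (v := -v)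
    (w := EuclideanSpace.single (0 : Fin n) ‖v‖) (by simp)
  have hmp : MeasurePreserving (fun z => T (z + -v))
      (volume : Measure (EuclideanSpace ℝ (Fin n))) volume :=
    T.measurePreserving.comp (measurePreserving_add_right volume (-v))
  have hzero (z : EuclideanSpace ℝ (Fin n)) :
      dist (T (z + -v)) (EuclideanSpace.single 0 ‖v‖) = dist z 0 := by
    rw [← hT, T.dist_map, dist_eq_norm, add_sub_cancel_right, dist_zero_right]
  have hv (z : EuclideanSpace ℝ (Fin n)) : dist (T (z + -v)) 0 = dist z v := by
    rw [dist_zero_right, T.norm_map, dist_eq_norm, sub_eq_add_neg]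
  refine Eq.trans ?_ (hmp.measureReal_preimage
    (measurableSet_closedBall.inter measurableSet_closedBall).nullMeasurableSet)
  congr 1
  ext z
  simp only [Set.mem_inter_iff, Metric.mem_closedBall, Set.mem_preimage, hzero, hv]

theorem interVolume_nonneg (r rd x : ℝ) : 0 ≤ interVolume n r rd x := measureReal_nonneg

theorem interVolume_le (r rd x : ℝ) :
    interVolume n r rd x
      ≤ (volume : Measure (EuclideanSpace ℝ (Fin n))).real (Metric.closedBall 0 r) :=
  measureReal_mono Set.inter_subset_left measure_closedBall_lt_top.ne

theorem interVolume_eq_zero {r rd x : ℝ} (h : r + rd < x) : interVolume n r rd x = 0 := by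
  rw [interVolume, Set.disjoint_iff_inter_eq_empty.1, measureReal_empty]
  refine Metric.closedBall_disjoint_closedBall ?_
  simpa using h.trans_le (le_abs_self x)

theorem measurable_interVolume (r rd : ℝ) : Measurable (interVolume n r rd) := by
  have hsingle : Continuous fun x : ℝ => EuclideanSpace.single (0 : Fin n) x :=
    (Isometry.of_dist_eq (PiLp.dist_single_same 2 (fun _ => ℝ) 0)).continuous
  have hclosed : IsClosed {q : ℝ × EuclideanSpace ℝ (Fin n) | q.2 ∈
      Metric.closedBall 0 r ∩ Metric.closedBall (EuclideanSpace.single 0 q.1) rd} :=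
    (isClosed_le (by fun_prop) (by fun_prop)).inter (isClosed_le (by fun_prop) (by fun_prop))
  exact (measurable_measure_prodMk_left hclosed.measurableSet).ennreal_toReal

theorem integral_comp_norm_sub {R : ℝ} (hR : 0 ≤ R) {φ : ℝ → ℝ}
    (hφ : ∀ x, R < x → φ x = 0) (y : EuclideanSpace ℝ (Fin n)) :
    ∫ x, φ ‖y - x‖ = n * unitBallVolume n * ∫ x in (0 : ℝ)..R, φ x * x ^ (n - 1) := by
  rw [integral_sub_left_eq_self (fun x => φ ‖x‖) volume y, integral_fun_norm_addHaar volume φ,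
    volume_real_unitBall, finrank_euclideanSpace_fin, intervalIntegral.integral_of_le hR,
    nsmul_eq_mul, smul_eq_mul, mul_assoc]
  simp_rw [smul_eq_mul, mul_comm (_ ^ (n - 1))]
  congr 2
  refine setIntegral_eq_of_subset_of_forall_sdiff_eq_zero measurableSet_Ioi
    Set.Ioc_subset_Ioi_self fun x ⟨hx0, hxR⟩ => ?_
  rw [hφ x (not_le.1 fun hx => hxR ⟨hx0, hx⟩), zero_mul]

theorem mul_integral_pow_pred (R : ℝ) : n * ∫ x in (0 : ℝ)..R, x ^ (n - 1) = R ^ n := by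
  obtain ⟨m, rfl⟩ := Nat.exists_eq_succ_of_ne_zero (NeZero.ne n)
  rw [Nat.succ_sub_one, integral_pow]
  push_cast
  field_simp
  simp

end Volume

section Matern

/-- The intensity measure of the parents of a Matérn cluster process. -/
def maternParentIntensity (n : ℕ) (lamP : ℝ) : Measure (EuclideanSpace ℝ (Fin n)) :=
  ENNReal.ofReal lamP • volume

/-- The intensity measure of each daughter process of a Matérn cluster process, relative to its
parent. -/
def maternDaughterIntensity (n : ℕ) (lamD rd : ℝ) : Measure (EuclideanSpace ℝ (Fin n)) :=
  ENNReal.ofReal lamD • volume.restrict (Metric.closedBall 0 rd)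

instance (n : ℕ) (lamP : ℝ) : SigmaFinite (maternParentIntensity n lamP) :=
  SMul.sigmaFinite (c := Real.toNNReal lamP)

instance (n : ℕ) (lamD rd : ℝ) : IsFiniteMeasure (maternDaughterIntensity n lamD rd) :=
  have : IsFiniteMeasure ((volume : Measure (EuclideanSpace ℝ (Fin n))).restrict
      (Metric.closedBall 0 rd)) := isFiniteMeasure_restrict.2 measure_closedBall_lt_top.ne
  Measure.smul_finite _ ENNReal.ofReal_ne_top

theorem IsMaternClustering.isPoissonClustering {Ω : Type*} [MeasurableSpace Ω] {n : ℕ}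
    {X : ℕ → Ω → EuclideanSpace ℝ (Fin n)} {C : ℕ → Ω → Set (EuclideanSpace ℝ (Fin n))}
    {lamP lamD rd : ℝ} {P : Measure Ω} (h : IsMaternClustering X C lamP lamD rd P) :
    IsPoissonClustering X C (maternParentIntensity n lamP) (maternDaughterIntensity n lamD rd) P :=
  ⟨h.measurable_parent, h.parent_injective, h.parent, h.daughter, h.daughter_indep,
    h.parent_indep_daughter⟩

variable {n : ℕ} [NeZero n] {lamP lamD rd r : ℝ} (y : EuclideanSpace ℝ (Fin n))

instance : NullSingletonClass (maternDaughterIntensity n lamD rd) :=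
  ⟨fun x => by simp [maternDaughterIntensity]⟩

theorem maternDaughterIntensity_real_preimage_closedBall (hlamD : 0 ≤ lamD)
    (x : EuclideanSpace ℝ (Fin n)) :
    (maternDaughterIntensity n lamD rd).real ((fun z => x + z) ⁻¹' Metric.closedBall y r)
      = lamD * interVolume n r rd ‖y - x‖ := by
  rw [maternDaughterIntensity, measureReal_ennreal_smul_apply, ENNReal.toReal_ofReal hlamD,
    preimage_add_closedBall, measureReal_restrict_apply measurableSet_closedBall,
    volume_real_closedBall_inter_closedBall]

theorem integrable_interVolume_norm_sub :
    Integrable (fun x => interVolume n r rd ‖y - x‖) := by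
  have hsupp : Function.support (fun x => interVolume n r rd ‖y - x‖)
      ⊆ Metric.closedBall y (r + rd) := fun x hx => by
    rw [Metric.mem_closedBall, dist_comm, dist_eq_norm]
    exact not_lt.1 fun hlt => hx (interVolume_eq_zero n hlt)
  have hbound (x : EuclideanSpace ℝ (Fin n)) : ‖interVolume n r rd ‖y - x‖‖
      ≤ (volume : Measure (EuclideanSpace ℝ (Fin n))).real (Metric.closedBall 0 r) := by
    rw [Real.norm_of_nonneg (interVolume_nonneg ..)]
    exact interVolume_le ..
  exact (integrableOn_iff_integrable_of_support_subset hsupp).1 <|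
    .of_bound measure_closedBall_lt_top
      ((measurable_interVolume n r rd).comp (by fun_prop)).aestronglyMeasurable _
      (ae_of_all _ hbound)

theorem integrable_const_mul_interVolume_norm_sub :
    Integrable (fun x => lamD * interVolume n r rd ‖y - x‖) (maternParentIntensity n lamP) :=
  ((integrable_interVolume_norm_sub y).smul_measure ENNReal.ofReal_ne_top).const_mul lamD

theorem intervalIntegrable_pow_mul_exp_neg_mul {u v : ℝ → ℝ} (hu : Measurable u) (hu0 : 0 ≤ u)
    (hv : Continuous v) (j : ℕ) (a b : ℝ) :
    IntervalIntegrable (fun x => u x ^ j * Real.exp (-u x) * v x) volume a b := by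
  have hbound (x : ℝ) : ‖u x ^ j * Real.exp (-u x)‖ ≤ ‖(j.factorial : ℝ)‖ := by
    rw [Real.norm_of_nonneg (mul_nonneg (pow_nonneg (hu0 x) j) (Real.exp_nonneg _)), Real.exp_neg,
      ← div_eq_mul_inv, Real.norm_natCast, div_le_comm₀ (Real.exp_pos _) (by positivity)]
    exact Real.pow_div_factorial_le_exp _ (hu0 x) j
  exact (intervalIntegrable_const.mono_fun (by fun_prop)
    (ae_of_all _ hbound)).mul_continuousOn hv.continuousOn

theorem poissonMixtureCoeff_interVolume (hlamP : 0 ≤ lamP) (hlamD : 0 ≤ lamD)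
    (hR : 0 ≤ r + rd) (j : ℕ) :
    poissonMixtureCoeff (maternParentIntensity n lamP)
        (fun x => lamD * interVolume n r rd ‖y - x‖) j
      = hCoeff n lamP lamD rd j r - lamP * unitBallVolume n * (r + rd) ^ n * 0 ^ j := by
  set u : ℝ → ℝ := fun x => lamD * interVolume n r rd x with hu
  have hint : IntervalIntegrable (fun x => u x ^ j * Real.exp (-u x) * x ^ (n - 1)) volume 0
      (r + rd) :=
    intervalIntegrable_pow_mul_exp_neg_mul ((measurable_interVolume n r rd).const_mul lamD)
      (fun x => mul_nonneg hlamD (interVolume_nonneg ..)) (by fun_prop) j _ _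
  have hpolar : ∫ x, poissonExcess j (u ‖y - x‖)
      = n * unitBallVolume n * ∫ x in (0 : ℝ)..(r + rd), poissonExcess j (u x) * x ^ (n - 1) := by
    refine integral_comp_norm_sub n hR (φ := fun x => poissonExcess j (u x))
      (fun x hx => ?_) y
    simp [hu, poissonExcess_apply_zero, interVolume_eq_zero n hx]
  have hsplit : ∫ x in (0 : ℝ)..(r + rd), poissonExcess j (u x) * x ^ (n - 1)
      = (∫ x in (0 : ℝ)..(r + rd), u x ^ j * Real.exp (-u x) * x ^ (n - 1)) / j.factorial
        - 0 ^ j * ∫ x in (0 : ℝ)..(r + rd), x ^ (n - 1) := by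
    rw [← intervalIntegral.integral_div, ← intervalIntegral.integral_const_mul,
      ← intervalIntegral.integral_sub (hint.div_const _)
        ((intervalIntegral.intervalIntegrable_pow _).const_mul _)]
    refine intervalIntegral.integral_congr fun x _ => ?_
    simp only [poissonExcess]
    ring
  rw [poissonMixtureCoeff, maternParentIntensity, integral_smul_measure,
    ENNReal.toReal_ofReal hlamP, smul_eq_mul, hpolar, hsplit, hCoeff,
    ← mul_integral_pow_pred n (r + rd)]
  ring

namespace IsMaternClustering

variable {Ω : Type*} [MeasurableSpace Ω] {X : ℕ → Ω → EuclideanSpace ℝ (Fin n)}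
  {C : ℕ → Ω → Set (EuclideanSpace ℝ (Fin n))} {P : Measure Ω}

theorem ae_count_closedBall_lt_top (h : IsMaternClustering X C lamP lamD rd P)
    (hlamD : 0 ≤ lamD) :
    ∀ᵐ ω ∂P, configMeasure (clusterUnion (X · ω) (C · ω)) (Metric.closedBall y r) < ∞ :=
  h.isPoissonClustering.ae_count_lt_top measurableSet_closedBall
    (maternDaughterIntensity_real_preimage_closedBall y hlamD)
    (integrable_const_mul_interVolume_norm_sub y)

theorem measureReal_natCast_le_count_closedBall (h : IsMaternClustering X C lamP lamD rd P)
    (hlamP : 0 ≤ lamP) (hlamD : 0 ≤ lamD) (hR : 0 ≤ r + rd) (k : ℕ) :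
    P.real {ω | (k : ℝ≥0∞) ≤
        configMeasure (clusterUnion (X · ω) (C · ω)) (Metric.closedBall y r)}
      = 1 - Real.exp (hCoeff n lamP lamD rd 0 r - lamP * unitBallVolume n * (r + rd) ^ n)
          * ∑ m ∈ Finset.range k, expCoeff (hCoeff n lamP lamD rd · r) m := by
  rw [h.isPoissonClustering.measureReal_natCast_le_count measurableSet_closedBall
    (maternDaughterIntensity_real_preimage_closedBall y hlamD)
    (integrable_const_mul_interVolume_norm_sub y),
    poissonMixtureCoeff_interVolume y hlamP hlamD hR, pow_zero, mul_one]
  congr! 3 with m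
  exact expCoeff_congr (fun i => by simp [poissonMixtureCoeff_interVolume y hlamP hlamD hR]) m

end IsMaternClustering

end Matern

end

theorem theorem2 {Ω : Type*} [MeasurableSpace Ω] (P : Measure Ω) [IsProbabilityMeasure P]
    (n : ℕ) [NeZero n] (lamP lamD rd : ℝ) (hlamP : 0 < lamP) (hlamD : 0 < lamD) (hrd : 0 < rd)
    (Φ : Ω → Set (EuclideanSpace ℝ (Fin n)))
    (hΦ : IsMaternClusterProcess Φ lamP lamD rd P)
    (y : EuclideanSpace ℝ (Fin n)) (k : ℕ) (hk : 1 ≤ k) :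
    AEMeasurable (fun ω => kthDist k y (Φ ω)) P ∧
    ∀ r : ℝ, 0 ≤ r →
      P.real {ω | kthDist k y (Φ ω) ≤ ENNReal.ofReal r} =
        1 - Real.exp (hCoeff n lamP lamD rd 0 r - lamP * unitBallVolume n * (r + rd) ^ n) *
          ∑ m ∈ Finset.range k, ∑ b ∈ tupleSet m,
            ∏ i : Fin m, hCoeff n lamP lamD rd ((i : ℕ) + 1) r ^ b i / (b i).factorial := by
  obtain ⟨X, C, h, hΦC⟩ := hΦ
  have hcount : ∀ᵐ ω ∂P, configMeasure (clusterUnion (X · ω) (C · ω)) = configMeasure (Φ ω) :=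
    hΦC.mono fun ω hω => congrArg configMeasure hω.symm
  have hmeas (r : ℝ) : AEMeasurable (fun ω => configMeasure (Φ ω) (Metric.closedBall y r)) P :=
    (h.isPoissonClustering.aemeasurable_count measurableSet_closedBall).congr <|
      hcount.mono fun ω hω => congrArg (· (Metric.closedBall y r)) hω
  have hfin : ∀ᵐ ω ∂P, ∀ r : ℝ, configMeasure (Φ ω) (Metric.closedBall y r) < ∞ := by
    refine ae_count_closedBall_lt_top fun r => ?_
    filter_upwards [h.ae_count_closedBall_lt_top y hlamD.le, hcount] with ω hω hωΦ
    rwa [← hωΦ]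
  refine ⟨aemeasurable_kthDist hmeas hfin, fun r hr => ?_⟩
  lift r to ℝ≥0 using hr
  refine (measureReal_congr ?_).trans
    (h.measureReal_natCast_le_count_closedBall y hlamP.le hlamD.le (r := r) (by positivity) k)
  filter_upwards [hfin, hcount] with ω hω hωΦ
  refine propext ?_
  change kthDist k y (Φ ω) ≤ ENNReal.ofReal r ↔ (k : ℝ≥0∞) ≤ configMeasure _ _
  rw [ENNReal.ofReal_coe_nnreal, hωΦ, kthDist_le_coe_iff hω]
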